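/- Let $b\ge 2$ be an integer and let $A=(a_n)_{n\ge 1}$ be a strictly increasing sequence of positive integers with $$\eta:=\limsup_{n\to\infty}\frac{a_{n+1}}{a_n}=1 .$$ Write $\|x\|$ for the distance from the real number $x$ to the nearest integer. For an irrational real number $\xi$ let $$v_{b,A}(\xi):=\sup\{v\ge 0:\ \|b^{a_n}\xi\|<(b^{a_n})^{-v}\ \text{for infinitely many } n\}\in[0,+\infty]$$ and $$\hat v_{b,A}(\xi):=\sup\Big\{w\ge 0:\ \min_{1\le n\le N}\|b^{a_n}\xi\|<(b^{a_N})^{-w}\ \text{for all sufficiently large } N\Big\}\in[0,+\infty].$$ Then for every real $\hat v\in(0,1)$ and every real $\theta\ge\frac{1}{1-\hat v}$, the two sets $$\{\xi\in\mathbb R\setminus\mathbb Q:\ \hat v_{b,A}(\xi)=\hat v\ \text{and}\ v_{b,A}(\xi)=\theta\hat v\}\quad\text{and}\quad \{\xi\in\mathbb R\setminus\mathbb Q:\ \hat v_{b,A}(\xi)\ge\hat v\ \text{and}\ v_{b,A}(\xi)=\theta\hat v\}$$ both have Hausdorff dimension $$\frac{\theta-1-\theta\hat v}{(\theta-1)(1+\theta\hat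 v)} .$$ -/

import Mathlib

open Filter Topology
open scoped ENNReal NNReal

namespace RestrictedDenominators

/-- The distance from a real number to the nearest integer. -/
noncomputable def distNearestInt (x : ℝ) : ℝ := |x - (round x : ℝ)|

/-- The number `η`, the limsup of the ratios `a (n + 1) / a n`, as an element of `[0, ∞]`. -/
noncomputable def ratioLimsup (a : ℕ → ℕ) : ℝ≥0∞ :=
  limsup (fun n : ℕ => (a (n + 1) : ℝ≥0∞) / (a n : ℝ≥0∞)) atTop

/-- The asymptotic exponent `v_{b,A}(ξ)`, as an element of `[0, ∞]`: the supremum of the `v ≥ 0` for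
which `‖b ^ (a n) ξ‖ < (b ^ (a n)) ^ (-v)` for infinitely many `n`. -/
noncomputable def asymptoticExponent (b : ℕ) (a : ℕ → ℕ) (ξ : ℝ) : ℝ≥0∞ :=
  ⨆ (v : ℝ≥0) (_ : ∃ᶠ n : ℕ in atTop,
    distNearestInt ((b : ℝ) ^ (a n) * ξ) < ((b : ℝ) ^ (a n)) ^ (-(v : ℝ))), (v : ℝ≥0∞)

/-- The uniform exponent of `ξ`, as an element of `[0, ∞]`: the supremum of the `v ≥ 0` for
which, for all large `N`, some `n ≤ N` satisfies `‖b ^ (a n) ξ‖ < (b ^ (a N)) ^ (-v)`.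
The terms of the sequence are `a 0 < a 1 < ⋯`, so that `n ≤ N` ranges over all terms up to `a N`. -/
noncomputable def uniformExponent (b : ℕ) (a : ℕ → ℕ) (ξ : ℝ) : ℝ≥0∞ :=
  ⨆ (v : ℝ≥0) (_ : ∀ᶠ N : ℕ in atTop, ∃ n ≤ N,
    distNearestInt ((b : ℝ) ^ (a n) * ξ) < ((b : ℝ) ^ (a N)) ^ (-(v : ℝ))), (v : ℝ≥0∞)

/-- The irrational `ξ` with asymptotic exponent equal to `v`. -/
def asymptoticEqSet (b : ℕ) (a : ℕ → ℕ) (v : ℝ≥0∞) : Set ℝ :=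
  {ξ : ℝ | Irrational ξ ∧ asymptoticExponent b a ξ = v}

/-- The irrational `ξ` with uniform exponent at least `v`. -/
def uniformGeSet (b : ℕ) (a : ℕ → ℕ) (v : ℝ≥0∞) : Set ℝ :=
  {ξ : ℝ | Irrational ξ ∧ v ≤ uniformExponent b a ξ}

/-- The irrational `ξ` with uniform exponent equal to `v`. -/
def uniformEqSet (b : ℕ) (a : ℕ → ℕ) (v : ℝ≥0∞) : Set ℝ :=
  {ξ : ℝ | Irrational ξ ∧ uniformExponent b a ξ = v}

end RestrictedDenominators

namespace RestrictedDenominators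

/-! ### Distance to the nearest integer under multiplication by powers of `b`. -/

section Basic

/-! Since `a (n + 1) / a n` has limsup 1, restricting to the terms of `a` changes neither exponent
(`uniformExponent_eq_id`, `asymptoticExponent_eq_id`), so everything reduces to the sequence of all
natural numbers.

Upper bound, for uniform exponent at least `vhat`. Call `N` a record if `‖b ^ N ξ‖` is a new strict
minimum. An earlier record `n` that is best up to `N - 1` satisfies, up to small errors, `b ^ (-θ
vhat n) ≤ ‖b ^ n ξ‖ < b ^ (-vhat N)`. So `n` is not much smaller than `N / θ`, and the numerator at
`n` leaves only about `b ^ (N - n - vhat N)` numerators at `N`. Iterating this recursion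
(`card_record_numerators_le`) leaves about `b ^ (N (1 - θ vhat / (θ - 1)))` numerators at record
level `N`. Infinitely many records approximate to order `θ vhat`, so covering by intervals of radius
`b ^ (-(1 + θ vhat) N)` (`dimH_le_of_frequently_close`) gives the stated quotient.

Lower bound, for uniform exponent equal to `vhat`. Group digits into words of length `l`, put zeros
in the words with index in `[A θ ^ k, (1 + θ vhat) A θ ^ k)`, start every other word with `01` and
leave its remaining digits free. The zero blocks determine both exponents (`blockReal_mem`). The
lower density of free digits tends to the stated quotient as `l` grows, and reading off the free
digits is a Hölder map onto `[0, 1]` whose exponent is essentially that density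
(`le_dimH_range_interleave`).

The set with equality lies in the set with inequality, so the two bounds settle both. -/

lemma distNearestInt_nonneg (x : ℝ) : 0 ≤ distNearestInt x := abs_nonneg _

lemma distNearestInt_le_abs_sub (x : ℝ) (m : ℤ) : distNearestInt x ≤ |x - m| := round_le x m

lemma distNearestInt_pow_mul_le (b k : ℕ) (x : ℝ) :
    distNearestInt ((b : ℝ) ^ k * x) ≤ (b : ℝ) ^ k * distNearestInt x := by
  refine (distNearestInt_le_abs_sub _ ((b : ℤ) ^ k * round x)).trans_eq ?_
  unfold distNearestInt
  push_cast
  rw [← mul_sub, abs_mul, abs_of_nonneg (by positivity : (0 : ℝ) ≤ (b : ℝ) ^ k)]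

lemma distNearestInt_eq_of_abs_sub_lt {x : ℝ} {m : ℤ} (h : |x - m| < 1 / 2) :
    distNearestInt x = |x - m| := by
  rw [abs_lt] at h
  have : round x = m := round_eq_iff.2 ⟨by linarith, by linarith⟩
  rw [distNearestInt, this]

/-- As long as the scaled error stays below 1/2, the nearest integer is just multiplied by `b ^ k`,
so the error grows exactly geometrically. -/
lemma distNearestInt_pow_mul_eq {b k : ℕ} {x : ℝ}
    (h : (b : ℝ) ^ k * distNearestInt x < 1 / 2) :
    distNearestInt ((b : ℝ) ^ k * x) = (b : ℝ) ^ k * distNearestInt x := by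
  have e : |(b : ℝ) ^ k * x - (((b : ℤ) ^ k * round x : ℤ) : ℝ)| =
      (b : ℝ) ^ k * distNearestInt x := by
    unfold distNearestInt
    push_cast
    rw [← mul_sub, abs_mul, abs_of_nonneg (by positivity : (0 : ℝ) ≤ (b : ℝ) ^ k)]
  rw [← e]
  exact distNearestInt_eq_of_abs_sub_lt (e ▸ h)

lemma distNearestInt_pos {x : ℝ} (hx : Irrational x) : 0 < distNearestInt x := by
  refine abs_pos.2 fun h => ?_
  exact hx ⟨(round x : ℚ), by push_cast; linarith⟩

lemma irrational_pow_mul {b : ℕ} (hb : 2 ≤ b) (n : ℕ) {ξ : ℝ} (h : Irrational ξ) :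
    Irrational ((b : ℝ) ^ n * ξ) := by
  have := h.natCast_mul (m := b ^ n) (by positivity)
  simpa using this

end Basic

/-- The condition in the definition of the uniform exponent, at a real exponent `w`. -/
def UnifApprox (b : ℕ) (a : ℕ → ℕ) (w ξ : ℝ) : Prop :=
  ∀ᶠ N : ℕ in atTop, ∃ n ≤ N,
    distNearestInt ((b : ℝ) ^ (a n) * ξ) < (b : ℝ) ^ (-(w * a N))

/-- The condition in the definition of the asymptotic exponent, at a real exponent `v`. -/
def AsymApprox (b : ℕ) (a : ℕ → ℕ) (v ξ : ℝ) : Prop :=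
  ∃ᶠ n : ℕ in atTop, distNearestInt ((b : ℝ) ^ (a n) * ξ) < (b : ℝ) ^ (-(v * a n))

/-! ### The exponents as suprema of down-closed conditions. -/

section Exponents

variable {b : ℕ} {a : ℕ → ℕ} {ξ : ℝ}

lemma pow_rpow_neg (b n : ℕ) (v : ℝ) : ((b : ℝ) ^ n) ^ (-v) = (b : ℝ) ^ (-(v * n)) := by
  rw [← Real.rpow_natCast, ← Real.rpow_mul (by positivity)]
  congr 1; ring

lemma uniformExponent_eq :
    uniformExponent b a ξ = ⨆ (v : ℝ≥0) (_ : UnifApprox b a v ξ), (v : ℝ≥0∞) := by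
  simp only [uniformExponent, UnifApprox, pow_rpow_neg]

lemma asymptoticExponent_eq :
    asymptoticExponent b a ξ = ⨆ (v : ℝ≥0) (_ : AsymApprox b a v ξ), (v : ℝ≥0∞) := by
  simp only [asymptoticExponent, AsymApprox, pow_rpow_neg]

lemma rpow_neg_mul_le (hb : 2 ≤ b) {v w : ℝ} (h : v ≤ w) (n : ℕ) :
    (b : ℝ) ^ (-(w * n)) ≤ (b : ℝ) ^ (-(v * n)) := by
  have : (1 : ℝ) ≤ b := by exact_mod_cast (by omega : 1 ≤ b)
  exact Real.rpow_le_rpow_of_exponent_le this (by gcongr)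

lemma UnifApprox.mono (hb : 2 ≤ b) {v w : ℝ} (h : v ≤ w) (H : UnifApprox b a w ξ) :
    UnifApprox b a v ξ :=
  Filter.Eventually.mono H fun _ ⟨n, hn, h'⟩ => ⟨n, hn, h'.trans_le (rpow_neg_mul_le hb h _)⟩

lemma AsymApprox.mono (hb : 2 ≤ b) {v w : ℝ} (h : v ≤ w) (H : AsymApprox b a w ξ) :
    AsymApprox b a v ξ :=
  Filter.Frequently.mono H fun _ h' => h'.trans_le (rpow_neg_mul_le hb h _)

/-- The supremum of a down-closed set of nonnegative reals, compared through strict bounds. -/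
lemma iSup_le_iSup_of_forall_lt (P Q : ℝ → Prop)
    (h : ∀ v w : ℝ, 0 ≤ v → v < w → P w → Q v) :
    (⨆ (v : ℝ≥0) (_ : P v), (v : ℝ≥0∞)) ≤ ⨆ (v : ℝ≥0) (_ : Q v), (v : ℝ≥0∞) := by
  refine iSup₂_le fun w hw => ENNReal.le_of_forall_nnreal_lt fun v hv => ?_
  exact le_iSup₂_of_le v (h v w v.2 (by exact_mod_cast hv) hw) le_rfl

lemma iSup_eq_ofReal {P : ℝ → Prop} {x : ℝ} (h1 : ∀ v, 0 ≤ v → v < x → P v)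
    (h2 : ∀ v, x < v → ¬ P v) : (⨆ (v : ℝ≥0) (_ : P v), (v : ℝ≥0∞)) = ENNReal.ofReal x := by
  apply le_antisymm
  · refine iSup₂_le fun w hw => ?_
    have : (w : ℝ) ≤ x := not_lt.1 fun h => h2 _ h hw
    rw [← ENNReal.ofReal_coe_nnreal]
    exact ENNReal.ofReal_le_ofReal this
  · refine ENNReal.le_of_forall_nnreal_lt fun v hv => ?_
    refine le_iSup₂_of_le v (h1 v v.2 ?_) le_rfl
    rw [← ENNReal.ofReal_coe_nnreal] at hv
    exact (ENNReal.ofReal_lt_ofReal_iff_of_nonneg v.2).1 hv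

lemma of_lt_iSup {P : ℝ → Prop} (hP : ∀ v w : ℝ, v ≤ w → P w → P v) {x v : ℝ}
    (h : ENNReal.ofReal x ≤ ⨆ (v : ℝ≥0) (_ : P v), (v : ℝ≥0∞)) (hx : 0 < x) (hv : v < x) :
    P v := by
  have h0 : ENNReal.ofReal v < ENNReal.ofReal x := (ENNReal.ofReal_lt_ofReal_iff hx).2 hv
  obtain ⟨w, hw⟩ := lt_iSup_iff.1 (h0.trans_le h)
  obtain ⟨hPw, hw⟩ := lt_iSup_iff.1 hw
  refine hP v w ?_ hPw
  rw [← ENNReal.ofReal_coe_nnreal] at hw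
  exact (ENNReal.lt_ofReal_iff_toReal_lt (by simp)).1 hw |>.le.trans' (by
    rw [ENNReal.toReal_ofReal']; exact le_max_left _ _)

lemma not_of_iSup_lt {P : ℝ → Prop} {x v : ℝ}
    (h : (⨆ (v : ℝ≥0) (_ : P v), (v : ℝ≥0∞)) ≤ ENNReal.ofReal x) (hx : 0 ≤ x) (hv : x < v) :
    ¬ P v := by
  intro hP
  lift v to ℝ≥0 using hx.trans hv.le
  have h1 : (v : ℝ≥0∞) ≤ ENNReal.ofReal x := (le_iSup₂_of_le v hP le_rfl).trans h
  rw [← ENNReal.ofReal_coe_nnreal, ENNReal.ofReal_le_ofReal_iff hx] at h1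
  exact absurd hv (not_lt.2 h1)

end Exponents

/-! ### Replacing the sequence `a` by all natural numbers. -/

section Restriction

variable {b : ℕ} {a : ℕ → ℕ} {ξ : ℝ}

/-- The form in which the limsup hypothesis is used: moving to the next term of `a` costs an
arbitrarily small loss in the exponent. -/
lemma eventually_mul_succ_le (ha_pos : ∀ n, 0 < a n) (hη : ratioLimsup a = 1) {w w' : ℝ}
    (hw : 0 ≤ w) (h : w < w') : ∀ᶠ n : ℕ in atTop, w * a (n + 1) ≤ w' * a n := by
  rcases hw.eq_or_lt with rfl | hw
  · exact Eventually.of_forall fun n => by rw [zero_mul]; positivity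
  have hw' : 0 < w' := hw.trans h
  have h1 : limsup (fun n : ℕ => (a (n + 1) : ℝ≥0∞) / (a n : ℝ≥0∞)) atTop <
      ENNReal.ofReal (w' / w) := by
    have := hη
    unfold ratioLimsup at this
    rw [this, ← ENNReal.ofReal_one]
    exact (ENNReal.ofReal_lt_ofReal_iff (by positivity)).2 ((one_lt_div hw).2 h)
  filter_upwards [eventually_lt_of_limsup_lt h1] with n hn
  have hpos : (0 : ℝ) < a n := by exact_mod_cast ha_pos n
  rw [← ENNReal.ofReal_natCast, ← ENNReal.ofReal_natCast, ← ENNReal.ofReal_div_of_pos hpos,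
    ENNReal.ofReal_lt_ofReal_iff (by positivity), div_lt_div_iff₀ hpos hw] at hn
  linarith

lemma exists_between_terms (ha : StrictMono a) {M : ℕ} (hM : a 0 ≤ M) :
    ∃ N, a N ≤ M ∧ M < a (N + 1) := by
  have hex : ∃ N, M < a (N + 1) := ⟨M, by have := ha.le_apply (x := M + 1); omega⟩
  classical
  refine ⟨Nat.find hex, ?_, Nat.find_spec hex⟩
  rcases h : Nat.find hex with _ | k
  · exact hM
  · exact not_lt.1 (Nat.find_min hex (by omega : k < Nat.find hex))

/-- The first term of `a` that is at least `n` overshoots by a factor at most `1 + ε`, except for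
finitely many terms, which the additive constant absorbs. Being first, its index is at most any `N`
with `n ≤ a N`, as the uniform exponent requires. -/
lemma exists_term_near (ha_pos : ∀ n, 0 < a n) (ha : StrictMono a) (hη : ratioLimsup a = 1)
    {ε : ℝ} (hε : 0 < ε) :
    ∃ C : ℝ, 0 ≤ C ∧ ∀ n : ℕ, ∃ i, n ≤ a i ∧ (a i : ℝ) ≤ (1 + ε) * n + C ∧
      ∀ N, n ≤ a N → i ≤ N := by
  obtain ⟨i₀, hi₀⟩ := eventually_atTop.1
    (eventually_mul_succ_le ha_pos hη zero_le_one (by linarith : (1 : ℝ) < 1 + ε))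
  refine ⟨a (i₀ + 1), by positivity, fun n => ?_⟩
  have hex : ∃ i, n ≤ a i := ⟨n, ha.le_apply⟩
  classical
  refine ⟨Nat.find hex, Nat.find_spec hex, ?_, fun N hN => Nat.find_min' hex hN⟩
  by_cases hle : Nat.find hex ≤ i₀ + 1
  · have : (a (Nat.find hex) : ℝ) ≤ a (i₀ + 1) := by exact_mod_cast ha.monotone hle
    have : 0 ≤ (1 + ε) * n := by positivity
    linarith
  · obtain ⟨k, hk⟩ : ∃ k, Nat.find hex = k + 1 := ⟨Nat.find hex - 1, by omega⟩
    have h1 : a k < n := not_le.1 (Nat.find_min hex (by omega : k < Nat.find hex))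
    have h2 := hi₀ k (by omega)
    have h3 : (a k : ℝ) ≤ n := by exact_mod_cast h1.le
    rw [hk]
    have : (0 : ℝ) ≤ a (i₀ + 1) := by positivity
    nlinarith

lemma distNearestInt_pow_le_of_le {n m : ℕ} (h : n ≤ m) :
    distNearestInt ((b : ℝ) ^ m * ξ) ≤
      (b : ℝ) ^ ((m : ℝ) - n) * distNearestInt ((b : ℝ) ^ n * ξ) := by
  have h1 := distNearestInt_pow_mul_le b (m - n) ((b : ℝ) ^ n * ξ)
  rw [← mul_assoc, ← pow_add, Nat.sub_add_cancel h] at h1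
  refine h1.trans_eq ?_
  rw [← Nat.cast_sub h, Real.rpow_natCast]

/-- For `a N ≤ M < a (N + 1)` the approximation found for `N` also serves `M`, because `w M ≤ w a (N
+ 1) ≤ w' a N`. -/
lemma UnifApprox.to_id (hb : 2 ≤ b) (ha_pos : ∀ n, 0 < a n) (ha : StrictMono a)
    (hη : ratioLimsup a = 1) {w w' : ℝ} (hw : 0 ≤ w) (h : w < w') (H : UnifApprox b a w' ξ) :
    UnifApprox b id w ξ := by
  have hb1 : (1 : ℝ) ≤ b := by exact_mod_cast (by omega : 1 ≤ b)
  obtain ⟨N₀, hN₀⟩ := eventually_atTop.1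
    (Filter.Eventually.and H (eventually_mul_succ_le ha_pos hη hw h))
  refine eventually_atTop.2 ⟨a N₀, fun M hM => ?_⟩
  obtain ⟨N, h1, h2⟩ := exists_between_terms ha ((ha.monotone N₀.zero_le).trans hM)
  have hN : N₀ ≤ N := by
    by_contra hlt
    have := ha.monotone (by omega : N + 1 ≤ N₀)
    omega
  obtain ⟨⟨n, hn, h3⟩, h4⟩ := hN₀ N hN
  refine ⟨a n, (ha.monotone hn).trans h1, h3.trans_le ?_⟩
  apply Real.rpow_le_rpow_of_exponent_le hb1
  have : w * M ≤ w * a (N + 1) := by gcongr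
  simp only [id]
  linarith

/-- Moving a good `n` up to the next term `a i` multiplies the distance by at most `b ^ (a i - n)`,
which the gap `w' - w` absorbs. -/
lemma UnifApprox.of_id (hb : 2 ≤ b) (ha_pos : ∀ n, 0 < a n) (ha : StrictMono a)
    (hη : ratioLimsup a = 1) {w w' : ℝ} (h : w < w') (H : UnifApprox b id w' ξ) :
    UnifApprox b a w ξ := by
  have hb1 : (1 : ℝ) ≤ b := by exact_mod_cast (by omega : 1 ≤ b)
  have hb0 : (0 : ℝ) < b := by linarith
  obtain ⟨C, -, hC⟩ := exists_term_near ha_pos ha hη (ε := (w' - w) / 2) (by linarith)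
  have hlim : Tendsto (fun N => (a N : ℝ)) atTop atTop :=
    tendsto_natCast_atTop_atTop.comp ha.tendsto_atTop
  filter_upwards [ha.tendsto_atTop.eventually H,
    hlim.eventually_ge_atTop (C / ((w' - w) / 2))] with N ⟨n, hn, h1⟩ h2
  obtain ⟨i, h3, h4, h5⟩ := hC n
  refine ⟨i, h5 N hn, (distNearestInt_pow_le_of_le h3).trans_lt ?_⟩
  simp only [id] at h1 hn
  refine (mul_lt_mul_of_pos_left h1 (by positivity)).trans_le ?_
  rw [← Real.rpow_add hb0]
  apply Real.rpow_le_rpow_of_exponent_le hb1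
  rw [div_le_iff₀ (by linarith)] at h2
  have : (n : ℝ) ≤ a N := by exact_mod_cast hn
  nlinarith

lemma AsymApprox.to_id (ha : StrictMono a) {v : ℝ} (H : AsymApprox b a v ξ) :
    AsymApprox b id v ξ :=
  ha.tendsto_atTop.frequently H

lemma AsymApprox.of_id (hb : 2 ≤ b) (ha_pos : ∀ n, 0 < a n) (ha : StrictMono a)
    (hη : ratioLimsup a = 1) {v v' : ℝ} (hv : 0 ≤ v) (h : v < v') (H : AsymApprox b id v' ξ) :
    AsymApprox b a v ξ := by
  have hb1 : (1 : ℝ) ≤ b := by exact_mod_cast (by omega : 1 ≤ b)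
  have hb0 : (0 : ℝ) < b := by linarith
  -- Replacing `n` by `a i` requires `(1 + v) a i ≤ (1 + v') n`; this `ε` spends half of `v' - v` on
  -- the factor `1 + ε` and keeps half for the constant `C`.
  set ε := (v' - v) / (2 * (1 + v)) with hε
  have hε' : (1 + v) * ε = (v' - v) / 2 := by rw [hε]; field_simp
  have hεpos : 0 < ε := div_pos (by linarith) (by linarith)
  obtain ⟨C, -, hC⟩ := exists_term_near ha_pos ha hη hεpos
  refine frequently_atTop.2 fun i₀ => ?_
  obtain ⟨n, hn, h1⟩ := frequently_atTop.1 H (max (a i₀) ⌈(1 + v) * C / ((v' - v) / 2)⌉₊)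
  obtain ⟨i, h3, h4, -⟩ := hC n
  refine ⟨i, ha.le_iff_le.1 ((le_max_left _ _).trans hn |>.trans h3), ?_⟩
  refine (distNearestInt_pow_le_of_le h3).trans_lt ?_
  simp only [id] at h1
  refine (mul_lt_mul_of_pos_left h1 (by positivity)).trans_le ?_
  rw [← Real.rpow_add hb0]
  apply Real.rpow_le_rpow_of_exponent_le hb1
  have h2 := Nat.ceil_le.1 ((le_max_right _ _).trans hn)
  rw [div_le_iff₀ (by linarith)] at h2
  have h6 : (1 + v) * a i ≤ (1 + v) * ((1 + ε) * n + C) := by gcongr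
  have h7 : (1 + v) * ((1 + ε) * n + C) = (1 + v) * n + (1 + v) * ε * n + (1 + v) * C := by ring
  rw [h7, hε'] at h6
  nlinarith

theorem uniformExponent_eq_id (hb : 2 ≤ b) (ha_pos : ∀ n, 0 < a n) (ha : StrictMono a)
    (hη : ratioLimsup a = 1) (ξ : ℝ) : uniformExponent b a ξ = uniformExponent b id ξ := by
  simp only [uniformExponent_eq]
  exact le_antisymm
    (iSup_le_iSup_of_forall_lt (UnifApprox b a · ξ) (UnifApprox b id · ξ) fun v w hv h H => H.to_id hb ha_pos ha hη hv h)
    (iSup_le_iSup_of_forall_lt (UnifApprox b id · ξ) (UnifApprox b a · ξ) fun v w _ h H => H.of_id hb ha_pos ha hη h)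

theorem asymptoticExponent_eq_id (hb : 2 ≤ b) (ha_pos : ∀ n, 0 < a n) (ha : StrictMono a)
    (hη : ratioLimsup a = 1) (ξ : ℝ) :
    asymptoticExponent b a ξ = asymptoticExponent b id ξ := by
  simp only [asymptoticExponent_eq]
  exact le_antisymm
    (iSup_le_iSup_of_forall_lt (AsymApprox b a · ξ) (AsymApprox b id · ξ) fun v w _ h H => (H.to_id ha).mono hb h.le)
    (iSup_le_iSup_of_forall_lt (AsymApprox b id · ξ) (AsymApprox b a · ξ) fun v w hv h H => H.of_id hb ha_pos ha hη hv h)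

end Restriction

/-! ### A covering bound for limsup sets around `b`-adic rationals. -/

section Covering

open MeasureTheory Measure

/-- A limsup set of intervals around `b`-adic rationals has small Hausdorff dimension when few
numerators occur at each level. -/
lemma dimH_le_of_frequently_close {b : ℕ} (hb : 2 ≤ b) {G : Set ℝ} {S : ℕ → Finset ℤ}
    {C e u : ℝ} {s : ℝ≥0} (hC : 0 ≤ C) (hS : ∀ N, ((S N).card : ℝ) ≤ C * (b : ℝ) ^ (e * N))
    (hu : 0 < 1 + u) (hs : e < s * (1 + u))
    (hG : ∀ ξ ∈ G, ∃ᶠ N : ℕ in atTop,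
      ∃ p ∈ S N, |(b : ℝ) ^ N * ξ - p| ≤ (b : ℝ) ^ (-(u * N))) :
    dimH G ≤ s := by
  have hb1 : (1 : ℝ) < b := by exact_mod_cast (by omega : 1 < b)
  have hb0 : (0 : ℝ) < b := by linarith
  -- Level `N` contributes at most a constant times `q ^ N` to the `s`-dimensional sum, so the tails
  -- of the cover tend to zero.
  set q : ℝ := (b : ℝ) ^ (e - s * (1 + u)) with hq
  have hq0 : 0 < q := Real.rpow_pos_of_pos hb0 _
  have hq1 : q < 1 := Real.rpow_lt_one_of_one_lt_of_neg hb1 (by linarith)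
  let r : ℕ → ℝ := fun N => (b : ℝ) ^ (-((1 + u) * N))
  have hr0 : ∀ N, 0 < r N := fun N => Real.rpow_pos_of_pos hb0 _
  have hrpow : ∀ N, r N = ((b : ℝ) ^ (-(1 + u))) ^ N := fun N => by
    rw [← Real.rpow_natCast, ← Real.rpow_mul hb0.le]; simp only [r]; congr 1; ring
  have hρ1 : (b : ℝ) ^ (-(1 + u)) < 1 := Real.rpow_lt_one_of_one_lt_of_neg hb1 (by linarith)
  have hρ0 : 0 < (b : ℝ) ^ (-(1 + u)) := Real.rpow_pos_of_pos hb0 _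
  let t : ∀ M : ℕ, (Σ N : ℕ, {p : ℤ // p ∈ S (N + M)}) → Set ℝ := fun M i =>
    Set.Icc ((i.2 : ℤ) / (b : ℝ) ^ (i.1 + M) - r (i.1 + M))
      ((i.2 : ℤ) / (b : ℝ) ^ (i.1 + M) + r (i.1 + M))
  have hdiam : ∀ M i, Metric.ediam (t M i) = ENNReal.ofReal (2 * r (i.1 + M)) := fun M i => by
    simp only [t, Real.ediam_Icc]; congr 1; ring
  have hbound : ∀ M, ∑' i, Metric.ediam (t M i) ^ (s : ℝ) ≤
      ENNReal.ofReal (C * 2 ^ (s : ℝ) * q ^ M / (1 - q)) := by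
    intro M
    rw [ENNReal.tsum_sigma']
    have hterm : ∀ N, ∑' p : {p : ℤ // p ∈ S (N + M)}, Metric.ediam (t M ⟨N, p⟩) ^ (s : ℝ) ≤
        ENNReal.ofReal (C * 2 ^ (s : ℝ) * q ^ M * q ^ N) := by
      intro N
      simp only [hdiam]
      rw [tsum_fintype, Finset.sum_const, Finset.card_univ, Fintype.card_coe, nsmul_eq_mul,
        ENNReal.ofReal_rpow_of_nonneg (by have := hr0 (N + M); positivity) s.coe_nonneg,
        ← ENNReal.ofReal_natCast, ← ENNReal.ofReal_mul (by positivity)]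
      apply ENNReal.ofReal_le_ofReal
      rw [Real.mul_rpow (by norm_num) (hr0 _).le]
      have h1 : r (N + M) ^ (s : ℝ) = (b : ℝ) ^ (-(s * (1 + u)) * (N + M : ℕ)) := by
        simp only [r]
        rw [← Real.rpow_mul hb0.le]; congr 1; ring
      have h2 : q ^ M * q ^ N =
          (b : ℝ) ^ (e * (N + M : ℕ)) * (b : ℝ) ^ (-(s * (1 + u)) * (N + M : ℕ)) := by
        rw [← pow_add, hq, ← Real.rpow_natCast, ← Real.rpow_mul hb0.le, ← Real.rpow_add hb0]
        congr 1; push_cast; ring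
      rw [mul_assoc (C * 2 ^ (s : ℝ)), h2, h1]
      have h3 := hS (N + M)
      have h4 : 0 ≤ (2 : ℝ) ^ (s : ℝ) * (b : ℝ) ^ (-(s * (1 + u)) * (N + M : ℕ)) := by positivity
      calc _ ≤ C * (b : ℝ) ^ (e * (N + M : ℕ)) *
            ((2 : ℝ) ^ (s : ℝ) * (b : ℝ) ^ (-(s * (1 + u)) * (N + M : ℕ))) :=
            mul_le_mul_of_nonneg_right h3 h4
        _ = _ := by ring
    refine (ENNReal.tsum_le_tsum hterm).trans_eq ?_
    rw [← ENNReal.ofReal_tsum_of_nonneg (fun N => by positivity)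
      ((summable_geometric_of_lt_one hq0.le hq1).mul_left _), tsum_mul_left,
      tsum_geometric_of_lt_one hq0.le hq1, div_eq_mul_inv]
  have hlim : Tendsto (fun M : ℕ => ENNReal.ofReal (C * 2 ^ (s : ℝ) * q ^ M / (1 - q))) atTop
      (𝓝 0) := by
    rw [← ENNReal.ofReal_zero]
    apply ENNReal.tendsto_ofReal
    have := ((tendsto_pow_atTop_nhds_zero_of_lt_one hq0.le hq1).const_mul
      (C * 2 ^ (s : ℝ))).div_const (1 - q)
    simpa using this
  have hzero : μH[s] G ≤ 0 := by
    refine (hausdorffMeasure_le_liminf_tsum (l := atTop) (s : ℝ) G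
      (fun M => ENNReal.ofReal (2 * r M)) ?_ t ?_ ?_).trans ?_
    · rw [← ENNReal.ofReal_zero]
      apply ENNReal.tendsto_ofReal
      simp only [hrpow]
      simpa using (tendsto_pow_atTop_nhds_zero_of_lt_one hρ0.le hρ1).const_mul 2
    · refine Eventually.of_forall fun M i => ?_
      rw [hdiam]
      apply ENNReal.ofReal_le_ofReal
      rw [hrpow, hrpow]
      have := pow_le_pow_of_le_one hρ0.le hρ1.le (by omega : M ≤ i.1 + M)
      linarith
    · refine Eventually.of_forall fun M ξ hξ => ?_
      obtain ⟨N, hN, p, hp, hclose⟩ := frequently_atTop.1 (hG ξ hξ) M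
      obtain ⟨k, rfl⟩ := Nat.exists_eq_add_of_le' hN
      refine Set.mem_iUnion.2 ⟨⟨k, p, hp⟩, ?_⟩
      have hbN : (0 : ℝ) < (b : ℝ) ^ (k + M) := by positivity
      have h1 : |ξ - p / (b : ℝ) ^ (k + M)| ≤ r (k + M) := by
        have e1 : ξ - p / (b : ℝ) ^ (k + M) = ((b : ℝ) ^ (k + M) * ξ - p) / (b : ℝ) ^ (k + M) := by
          field_simp
        rw [e1, abs_div, abs_of_pos hbN, div_le_iff₀ hbN]
        refine hclose.trans_eq ?_
        simp only [r]
        rw [← Real.rpow_natCast, ← Real.rpow_add hb0]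
        congr 1; ring
      rw [abs_le] at h1
      simp only [t, Set.mem_Icc]
      constructor <;> linarith
    · exact (liminf_le_liminf (Eventually.of_forall hbound)).trans_eq hlim.liminf_eq
  exact dimH_le_of_hausdorffMeasure_ne_top (by rw [nonpos_iff_eq_zero.1 hzero]; simp)

end Covering

/-! ### Counting numerators at record levels. -/

section Records

variable {b : ℕ} {ξ : ℝ}

/-- The index `N` is a record of `ξ` if `b ^ N * ξ` is closer to the integers than all its
predecessors. -/
def IsRecord (b : ℕ) (ξ : ℝ) (N : ℕ) : Prop :=
  ∀ j < N, distNearestInt ((b : ℝ) ^ N * ξ) < distNearestInt ((b : ℝ) ^ j * ξ)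

lemma exists_isRecord_le (b : ℕ) (ξ : ℝ) (N : ℕ) : ∃ n ≤ N, IsRecord b ξ n ∧
    ∀ j ≤ N, distNearestInt ((b : ℝ) ^ n * ξ) ≤ distNearestInt ((b : ℝ) ^ j * ξ) := by
  induction N with
  | zero =>
    exact ⟨0, le_rfl, fun j hj => absurd hj (by omega), fun j hj => by
      rw [Nat.le_zero.1 hj]⟩
  | succ N ih =>
    by_cases h : IsRecord b ξ (N + 1)
    · refine ⟨N + 1, le_rfl, h, fun j hj => ?_⟩
      rcases hj.eq_or_lt with rfl | hj
      · exact le_rfl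
      · exact (h j hj).le
    · obtain ⟨n, hn, hr, hmin⟩ := ih
      refine ⟨n, by omega, hr, fun j hj => ?_⟩
      rcases hj.eq_or_lt with rfl | hj
      · simp only [IsRecord, not_forall, not_lt] at h
        obtain ⟨i, hi, h⟩ := h
        exact (hmin i (by omega)).trans h
      · exact hmin j (by omega)

/-- Replace a good `N` by the record `n ≤ N` attaining the minimum: the distance does not increase
and the bound at `n` is weaker. Irrationality makes the minimum over indices up to `M` positive,
which forces `n > M` once the distance is small enough. -/
lemma frequently_isRecord (hb : 2 ≤ b) (hξ : Irrational ξ) {u : ℝ} (hu : 0 < u)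
    (h : AsymApprox b id u ξ) : ∃ᶠ N : ℕ in atTop, IsRecord b ξ N ∧
      distNearestInt ((b : ℝ) ^ N * ξ) < (b : ℝ) ^ (-(u * N)) := by
  have hb1 : (1 : ℝ) < b := by exact_mod_cast (by omega : 1 < b)
  have hb0 : (0 : ℝ) < b := by linarith
  refine frequently_atTop.2 fun M => ?_
  obtain ⟨m, -, -, hm⟩ := exists_isRecord_le b ξ M
  have hpos := distNearestInt_pos (irrational_pow_mul hb m hξ)
  have hlim : Tendsto (fun N : ℕ => (b : ℝ) ^ (-(u * N))) atTop (𝓝 0) := by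
    have h1 : (b : ℝ) ^ (-u) < 1 := Real.rpow_lt_one_of_one_lt_of_neg hb1 (by linarith)
    refine (tendsto_pow_atTop_nhds_zero_of_lt_one (by positivity) h1).congr fun N => ?_
    rw [← Real.rpow_natCast, ← Real.rpow_mul hb0.le]; congr 1; ring
  obtain ⟨N, hN, h1⟩ := (h.and_eventually (hlim.eventually_lt_const hpos)).exists
  obtain ⟨n, hn, hr, hmin⟩ := exists_isRecord_le b ξ N
  have h2 : distNearestInt ((b : ℝ) ^ n * ξ) < (b : ℝ) ^ (-(u * N)) := (hmin N le_rfl).trans_lt hN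
  refine ⟨n, ?_, hr, h2.trans_le ?_⟩
  · by_contra hlt
    exact absurd (hm n (by omega)) (not_le.2 (h2.trans h1))
  · apply Real.rpow_le_rpow_of_exponent_le hb1.le
    have : (n : ℝ) ≤ N := by exact_mod_cast hn
    nlinarith

/-- A record cannot fall inside the block of an earlier close approximation. -/
lemma IsRecord.half_le (hb : 2 ≤ b) {n N : ℕ} (h : IsRecord b ξ N) (hn : n < N) :
    1 / 2 ≤ (b : ℝ) ^ (N - n) * distNearestInt ((b : ℝ) ^ n * ξ) := by
  have hb1 : (1 : ℝ) ≤ b := by exact_mod_cast (by omega : 1 ≤ b)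
  by_contra! hlt
  have h1 := distNearestInt_pow_mul_eq hlt
  rw [← mul_assoc, ← pow_add, Nat.sub_add_cancel hn.le] at h1
  have h2 := h n hn
  rw [h1] at h2
  have h3 := one_le_pow₀ (n := N - n) hb1
  have := distNearestInt_nonneg ((b : ℝ) ^ n * ξ)
  nlinarith

lemma card_Icc_le (B y : ℝ) (hy : 0 ≤ y) :
    ((Finset.Icc ⌈B - y - 1⌉ ⌊B + y + 1⌋).card : ℝ) ≤ 2 * y + 3 := by
  rw [Int.card_Icc]
  have h1 := Int.le_ceil (B - y - 1)
  have h2 := Int.floor_le (B + y + 1)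
  have : (((⌊B + y + 1⌋ + 1 - ⌈B - y - 1⌉).toNat : ℤ) : ℝ) ≤ 2 * y + 3 := by
    rw [Int.toNat_eq_max]
    push_cast
    exact max_le (by linarith) (by linarith)
  exact_mod_cast this

/-- The number of numerators at record levels, for points with uniform exponent at least `w` and
asymptotic exponent at most `v`. -/
lemma card_record_numerators_le (hb : 2 ≤ b) {G : Set ℝ} {K : ℤ} {N₀ : ℕ} {w v h δ C₀ : ℝ}
    (hw : 0 < w) (hh : 0 ≤ h) (hhv : h * (v - w) = w) (hδ : 0 < δ)
    (hK : ∀ ξ ∈ G, ξ ∈ Set.Ico (K : ℝ) (K + 1))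
    (hGw : ∀ ξ ∈ G, ∀ N ≥ N₀, ∃ n ≤ N,
      distNearestInt ((b : ℝ) ^ n * ξ) < (b : ℝ) ^ (-(w * N)))
    (hGv : ∀ ξ ∈ G, ∀ n : ℕ, (b : ℝ) ^ (-(C₀ + v * n)) ≤ distNearestInt ((b : ℝ) ^ n * ξ)) :
    ∃ C : ℝ, 0 ≤ C ∧ ∃ S : ℕ → Finset ℤ,
      (∀ N, ((S N).card : ℝ) ≤ C * (b : ℝ) ^ ((1 - h * v + δ) * N)) ∧
      ∀ N, ∀ ξ ∈ G, IsRecord b ξ N → round ((b : ℝ) ^ N * ξ) ∈ S N := by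
  have hb1 : (1 : ℝ) < b := by exact_mod_cast (by omega : 1 < b)
  have hb0 : (0 : ℝ) < b := by linarith
  set e := 1 - h * v + δ with he
  set C₃ : ℝ := w + h * (w + C₀) + δ * (1 + w) with hC₃
  -- the recursion loses nothing from some level on
  have hlim : Tendsto (fun N : ℕ => (2 + 3 * b) * (b : ℝ) ^ C₃ * (N * ((b : ℝ) ^ (-(δ * w))) ^ N))
      atTop (𝓝 0) := by
    have h1 : (b : ℝ) ^ (-(δ * w)) < 1 :=
      Real.rpow_lt_one_of_one_lt_of_neg hb1 (by have := mul_pos hδ hw; linarith)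
    simpa using (tendsto_self_mul_const_pow_of_lt_one (by positivity) h1).const_mul
      ((2 + 3 * b) * (b : ℝ) ^ C₃)
  obtain ⟨N₁, hN₁⟩ := eventually_atTop.1 (hlim.eventually_le_const zero_lt_one)
  -- Below `T` all numerators of points of `[K, K + 1)` are admitted and `C` pays for them. From `T`
  -- on the uniform condition applies at `N - 1`, and the recursion loses nothing.
  set T := max N₁ (N₀ + 1) with hT
  set C : ℝ := ∑ i ∈ Finset.range T, ((b : ℝ) ^ i + 1) * (b : ℝ) ^ (-(e * i)) with hC
  have hC0 : 0 ≤ C := Finset.sum_nonneg fun i _ => by positivity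
  suffices H : ∀ N : ℕ, ∃ S : Finset ℤ, ((S.card : ℝ) ≤ C * (b : ℝ) ^ (e * N)) ∧
      ∀ ξ ∈ G, IsRecord b ξ N → round ((b : ℝ) ^ N * ξ) ∈ S by
    choose S hS1 hS2 using H
    exact ⟨C, hC0, S, hS1, hS2⟩
  intro N
  induction N using Nat.strong_induction_on with
  | _ N ih =>
  by_cases hN : N < T
  · refine ⟨Finset.Icc ((b : ℤ) ^ N * K) ((b : ℤ) ^ N * K + (b : ℤ) ^ N), ?_, fun ξ hξ _ => ?_⟩
    · rw [Int.card_Icc]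
      have h1 : ((b : ℤ) ^ N * K + (b : ℤ) ^ N + 1 - (b : ℤ) ^ N * K).toNat = b ^ N + 1 := by
        rw [show (b : ℤ) ^ N * K + (b : ℤ) ^ N + 1 - (b : ℤ) ^ N * K = ((b ^ N + 1 : ℕ) : ℤ) by
          push_cast; ring, Int.toNat_natCast]
      rw [h1]
      have h2 : ((b : ℝ) ^ N + 1) * (b : ℝ) ^ (-(e * N)) ≤ C :=
        Finset.single_le_sum (f := fun i : ℕ => ((b : ℝ) ^ i + 1) * (b : ℝ) ^ (-(e * i)))
          (fun i _ => by positivity) (Finset.mem_range.2 hN)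
      calc ((b ^ N + 1 : ℕ) : ℝ) = ((b : ℝ) ^ N + 1) * (b : ℝ) ^ (-(e * N)) * (b : ℝ) ^ (e * N) := by
            rw [mul_assoc, ← Real.rpow_add hb0]; simp
        _ ≤ _ := by gcongr
    · obtain ⟨h1, h2⟩ := hK ξ hξ
      have hpow : (0 : ℝ) < (b : ℝ) ^ N := by positivity
      have h3 := mul_le_mul_of_nonneg_left h1 hpow.le
      have h4 := mul_lt_mul_of_pos_left h2 hpow
      rw [Finset.mem_Icc, round_eq, Int.le_floor, ← Int.lt_add_one_iff, Int.floor_lt]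
      push_cast
      constructor <;> linarith
  · push Not at hN
    have hNN₁ : N₁ ≤ N := (le_max_left _ _).trans hN
    have hNN₀ : N₀ + 1 ≤ N := (le_max_right _ _).trans hN
    choose! S hS1 hS2 using ih
    classical
    -- The error at level `N` inherited from a record `n` with `‖b ^ n ξ‖ < b ^ (-(w (N - 1)))`.
    let y : ℕ → ℝ := fun n => (b : ℝ) ^ ((N : ℝ) - n - w * (N - 1))
    have hy : ∀ n, 0 < y n := fun n => Real.rpow_pos_of_pos hb0 _
    -- The possible preceding records: the first condition comes from the lower bound `hGv`, the
    -- second from `IsRecord.half_le`, which makes `y n` at least `1 / b`.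
    let J : Finset ℕ := (Finset.range N).filter fun n =>
      w * N - w ≤ C₀ + v * n ∧ (-1 : ℝ) ≤ (N : ℝ) - n - w * (N - 1)
    refine ⟨J.biUnion fun n => (S n).biUnion fun p => Finset.Icc ⌈(b : ℝ) ^ (N - n) * p - y n - 1⌉
      ⌊(b : ℝ) ^ (N - n) * p + y n + 1⌋, ?_, fun ξ hξ hrec => ?_⟩
    · have hcard : ∀ n ∈ J, (((S n).biUnion fun p => Finset.Icc
          ⌈(b : ℝ) ^ (N - n) * p - y n - 1⌉ ⌊(b : ℝ) ^ (N - n) * p + y n + 1⌋).card : ℝ) ≤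
          C * (2 + 3 * b) * (b : ℝ) ^ C₃ * ((b : ℝ) ^ (-(δ * w))) ^ N * (b : ℝ) ^ (e * N) := by
        intro n hn
        obtain ⟨hnN, hn1, hn2⟩ := Finset.mem_filter.1 hn
        have h1 : (((S n).biUnion fun p => Finset.Icc
            ⌈(b : ℝ) ^ (N - n) * p - y n - 1⌉ ⌊(b : ℝ) ^ (N - n) * p + y n + 1⌋).card : ℝ) ≤
            ∑ p ∈ S n, (2 * y n + 3) := by
          refine (Nat.cast_le.2 Finset.card_biUnion_le).trans ?_
          push_cast
          exact Finset.sum_le_sum fun p _ => card_Icc_le _ _ (hy n).le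
        rw [Finset.sum_const, nsmul_eq_mul] at h1
        have h2 : 1 ≤ b * y n := by
          have : b * y n = (b : ℝ) ^ (1 + ((N : ℝ) - n - w * (N - 1))) := by
            rw [Real.rpow_add hb0, Real.rpow_one]
          rw [this]
          exact Real.one_le_rpow hb1.le (by linarith)
        have h3 := hS1 n (Finset.mem_range.1 hnN)
        have h4 : (b : ℝ) ^ (e * n) * y n ≤
            (b : ℝ) ^ C₃ * ((b : ℝ) ^ (-(δ * w))) ^ N * (b : ℝ) ^ (e * N) := by
          rw [← Real.rpow_natCast, ← Real.rpow_mul hb0.le, ← Real.rpow_add hb0,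
            ← Real.rpow_add hb0, ← Real.rpow_add hb0]
          apply Real.rpow_le_rpow_of_exponent_le hb1.le
          -- The relation `h * (v - w) = w` makes the terms `w * N` cancel in the exponents. The
          -- second condition in `J` bounds `N - n` from below and so yields the gain `δ * w * N`,
          -- which pays for the at most `N` choices of `n`.
          have h5 := mul_le_mul_of_nonneg_left hn1 hh
          have h6 := mul_le_mul_of_nonneg_left hn2 hδ.le
          have h7 : h * v = h * w + w := by linarith
          have h8 : h * v * N = (h * w + w) * N := by rw [h7]
          rw [he, hC₃]
          nlinarith
        have hyn := hy n
        calc _ ≤ ((S n).card : ℝ) * (2 * y n + 3) := h1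
          _ ≤ ((S n).card : ℝ) * ((2 + 3 * b) * y n) := by gcongr; linarith
          _ ≤ C * (b : ℝ) ^ (e * n) * ((2 + 3 * b) * y n) := by gcongr
          _ = C * (2 + 3 * b) * ((b : ℝ) ^ (e * n) * y n) := by ring
          _ ≤ C * (2 + 3 * b) * ((b : ℝ) ^ C₃ * ((b : ℝ) ^ (-(δ * w))) ^ N * (b : ℝ) ^ (e * N)) := by
            gcongr
          _ = _ := by ring
      have hJ : (J.card : ℝ) ≤ N := by
        have := Finset.card_filter_le (Finset.range N) fun n : ℕ =>
          w * N - w ≤ C₀ + v * n ∧ (-1 : ℝ) ≤ (N : ℝ) - n - w * (N - 1)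
        rw [Finset.card_range] at this
        exact Nat.cast_le.2 this
      refine (Nat.cast_le.2 Finset.card_biUnion_le).trans ?_
      push_cast
      refine (Finset.sum_le_sum hcard).trans ?_
      rw [Finset.sum_const, nsmul_eq_mul]
      have hle := hN₁ N hNN₁
      calc _ ≤ (N : ℝ) * (C * (2 + 3 * b) * (b : ℝ) ^ C₃ * ((b : ℝ) ^ (-(δ * w))) ^ N *
            (b : ℝ) ^ (e * N)) := by gcongr
        _ = C * (b : ℝ) ^ (e * N) *
            ((2 + 3 * b) * (b : ℝ) ^ C₃ * (N * ((b : ℝ) ^ (-(δ * w))) ^ N)) := by ring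
        _ ≤ C * (b : ℝ) ^ (e * N) * 1 := by gcongr
        _ = _ := mul_one _
    · obtain ⟨m, hm, hm1⟩ := hGw ξ hξ (N - 1) (by omega)
      -- The uniform condition gives some index up to `N - 1`; passing to the best one makes it a
      -- record, so the induction hypothesis covers its numerator.
      obtain ⟨n, hn, hnrec, hmin⟩ := exists_isRecord_le b ξ (N - 1)
      have hN1 : ((N - 1 : ℕ) : ℝ) = (N : ℝ) - 1 := by
        rw [Nat.cast_sub (by omega)]; simp
      have hclose := (hmin m hm).trans_lt hm1
      rw [hN1] at hclose
      have hnN : n < N := by omega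
      have hpow : (b : ℝ) ^ (N - n) = (b : ℝ) ^ ((N : ℝ) - n) := by
        rw [← Nat.cast_sub hnN.le, Real.rpow_natCast]
      have hyclose : (b : ℝ) ^ (N - n) * distNearestInt ((b : ℝ) ^ n * ξ) < y n := by
        have : y n = (b : ℝ) ^ (N - n) * (b : ℝ) ^ (-(w * ((N : ℝ) - 1))) := by
          rw [hpow, ← Real.rpow_add hb0]
          simp only [y]
          ring_nf
        rw [this]
        gcongr
      have hJ : n ∈ J := by
        refine Finset.mem_filter.2 ⟨Finset.mem_range.2 hnN, ?_, ?_⟩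
        · have := (hGv ξ hξ n).trans_lt hclose
          rw [Real.rpow_lt_rpow_left_iff hb1] at this
          linarith
        · have h1 := (hrec.half_le hb hnN).trans_lt hyclose
          have h2 : (b : ℝ) ^ (-1 : ℝ) ≤ 1 / 2 := by
            rw [Real.rpow_neg_one, one_div]
            exact inv_anti₀ two_pos (by exact_mod_cast hb)
          exact ((Real.rpow_lt_rpow_left_iff hb1).1 (h2.trans_lt h1)).le
      refine Finset.mem_biUnion.2 ⟨n, hJ, Finset.mem_biUnion.2
        ⟨_, hS2 n hnN ξ hξ hnrec, ?_⟩⟩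
      have h1 := abs_sub_round ((b : ℝ) ^ N * ξ)
      have h2 : |(b : ℝ) ^ N * ξ - (b : ℝ) ^ (N - n) * round ((b : ℝ) ^ n * ξ)| < y n := by
        have : (b : ℝ) ^ N * ξ - (b : ℝ) ^ (N - n) * round ((b : ℝ) ^ n * ξ) =
            (b : ℝ) ^ (N - n) * ((b : ℝ) ^ n * ξ - round ((b : ℝ) ^ n * ξ)) := by
          rw [mul_sub, ← mul_assoc, ← pow_add, Nat.sub_add_cancel hnN.le]
        rw [this, abs_mul, abs_of_nonneg (by positivity)]
        exact hyclose
      rw [abs_le] at h1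
      rw [abs_lt] at h2
      rw [Finset.mem_Icc, Int.ceil_le, Int.le_floor]
      constructor <;> linarith

end Records

/-! ### The upper bound for the dimension. -/

section UpperBound

variable {b : ℕ}

/-- The finitely many exceptional `n` have positive distance and are absorbed in `C₀`. Taking `C₀`
natural allows a countable decomposition. -/
lemma exists_rpow_le_of_not_asymApprox (hb : 2 ≤ b) {ξ v : ℝ} (hξ : Irrational ξ)
    (h : ¬ AsymApprox b id v ξ) : ∃ C₀ : ℕ, ∀ n : ℕ,
      (b : ℝ) ^ (-((C₀ : ℝ) + v * n)) ≤ distNearestInt ((b : ℝ) ^ n * ξ) := by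
  have hb1 : (1 : ℝ) < b := by exact_mod_cast (by omega : 1 < b)
  have hb0 : (0 : ℝ) < b := by linarith
  simp only [AsymApprox, not_frequently, not_lt, id] at h
  obtain ⟨n₁, hn₁⟩ := eventually_atTop.1 h
  have hlim : ∀ n : ℕ, ∀ᶠ C₀ : ℕ in atTop,
      (b : ℝ) ^ (-((C₀ : ℝ) + v * n)) ≤ distNearestInt ((b : ℝ) ^ n * ξ) := fun n => by
    have h1 : Tendsto (fun C₀ : ℕ => (b : ℝ) ^ (-((C₀ : ℝ) + v * n))) atTop (𝓝 0) := by
      have h2 : Tendsto (fun C₀ : ℕ => ((b : ℝ)⁻¹) ^ C₀ * (b : ℝ) ^ (-(v * n))) atTop (𝓝 0) := by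
        simpa using (tendsto_pow_atTop_nhds_zero_of_lt_one (by positivity)
          (inv_lt_one_of_one_lt₀ hb1)).mul_const ((b : ℝ) ^ (-(v * n)))
      refine h2.congr fun C₀ => ?_
      rw [neg_add, Real.rpow_add hb0, Real.rpow_neg hb0.le (C₀ : ℝ), Real.rpow_natCast, inv_pow]
    exact h1.eventually_le_const (distNearestInt_pos (irrational_pow_mul hb n hξ))
  obtain ⟨C₀, hC₀⟩ := ((Filter.eventually_all_finset (Finset.range n₁)).2 fun n _ => hlim n).exists
  refine ⟨C₀, fun n => ?_⟩
  by_cases hn : n < n₁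
  · exact hC₀ n (Finset.mem_range.2 hn)
  · refine le_trans ?_ (hn₁ n (by omega))
    apply Real.rpow_le_rpow_of_exponent_le hb1.le
    have : (0 : ℝ) ≤ C₀ := by positivity
    linarith

/-- Points for which the uniform, asymptotic and lower conditions hold with fixed constants. -/
def boundedApproxSet (b : ℕ) (w v u : ℝ) (i : ℤ × ℕ × ℕ) : Set ℝ :=
  {ξ : ℝ | ξ ∈ Set.Ico (i.1 : ℝ) (i.1 + 1) ∧ Irrational ξ ∧
    (∀ N ≥ i.2.1, ∃ n ≤ N, distNearestInt ((b : ℝ) ^ n * ξ) < (b : ℝ) ^ (-(w * N))) ∧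
    (∀ n : ℕ, (b : ℝ) ^ (-((i.2.2 : ℝ) + v * n)) ≤ distNearestInt ((b : ℝ) ^ n * ξ)) ∧
    AsymApprox b id u ξ}

lemma dimH_boundedApproxSet_le (hb : 2 ≤ b) {w v u h δ : ℝ} {s : ℝ≥0} (hw : 0 < w) (hu : 0 < u)
    (hh : 0 ≤ h) (hhv : h * (v - w) = w) (hδ : 0 < δ) (hs : 1 - h * v + δ < s * (1 + u))
    (i : ℤ × ℕ × ℕ) : dimH (boundedApproxSet b w v u i) ≤ s := by
  obtain ⟨C, hC, S, hS, hmem⟩ := card_record_numerators_le hb (G := boundedApproxSet b w v u i)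
    hw hh hhv hδ (fun ξ hξ => hξ.1) (fun ξ hξ => hξ.2.2.1) (fun ξ hξ => hξ.2.2.2.1)
  refine dimH_le_of_frequently_close hb hC hS (by linarith) hs fun ξ hξ => ?_
  exact (frequently_isRecord hb hξ.2.1 hu hξ.2.2.2.2).mono fun N ⟨hrec, hlt⟩ =>
    ⟨_, hmem N ξ hξ hrec, hlt.le⟩

/-- Upper bound for the dimension of the points with uniform exponent at least `vhat` and asymptotic
exponent `θ * vhat`. -/
theorem dimH_uniformGe_inter_asymptoticEq_le (hb : 2 ≤ b) {vhat θ : ℝ} (hv : 0 < vhat)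
    (hθ : 1 < θ) :
    dimH (uniformGeSet b id (ENNReal.ofReal vhat) ∩
      asymptoticEqSet b id (ENNReal.ofReal (θ * vhat))) ≤
      ENNReal.ofReal ((θ - 1 - θ * vhat) / ((θ - 1) * (1 + θ * vhat))) := by
  refine le_of_forall_gt_imp_ge_of_dense fun c hc => ?_
  obtain ⟨s, hs, hsc⟩ := ENNReal.lt_iff_exists_nnreal_btwn.1 hc
  refine le_trans ?_ hsc.le
  have hθv : 0 < θ * vhat := by positivity
  have hs' : (θ - 1 - θ * vhat) / ((θ - 1) * (1 + θ * vhat)) < s := by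
    rw [← ENNReal.ofReal_coe_nnreal] at hs
    exact (ENNReal.ofReal_lt_ofReal_iff'.1 hs).1
  -- The strict inequality holds at `ε = 0`, where the left side is `1 - θ vhat / (θ - 1)`, and
  -- extends to small positive `ε` by continuity.
  obtain ⟨ε, hε0, hε1, hε2⟩ : ∃ ε : ℝ, 0 < ε ∧ ε < vhat ∧
      1 - (vhat - ε) / ((θ * vhat + ε) - (vhat - ε)) * (θ * vhat + ε) + ε <
        s * (1 + (θ * vhat - ε)) := by
    have hne : (θ * vhat + 0) - (vhat - 0) ≠ 0 := by nlinarith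
    have hcont : ContinuousAt (fun ε : ℝ => 1 - (vhat - ε) / ((θ * vhat + ε) - (vhat - ε)) *
        (θ * vhat + ε) + ε - s * (1 + (θ * vhat - ε))) 0 := by
      fun_prop (disch := exact hne)
    have h0 : 1 - (vhat - 0) / ((θ * vhat + 0) - (vhat - 0)) *
        (θ * vhat + 0) + 0 - s * (1 + (θ * vhat - 0)) < 0 := by
      rw [div_lt_iff₀ (by nlinarith)] at hs'
      have h1 : θ - 1 ≠ 0 := by linarith
      have h2 : (vhat - 0) / ((θ * vhat + 0) - (vhat - 0)) * (θ * vhat + 0) =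
          θ * vhat / (θ - 1) := by
        have : vhat ≠ 0 := hv.ne'
        have h3 : (θ * vhat + 0) - (vhat - 0) = vhat * (θ - 1) := by ring
        rw [h3]; field_simp; ring
      rw [h2]
      have h4 : θ * vhat / (θ - 1) * (θ - 1) = θ * vhat := by field_simp
      have h5 : (1 - θ * vhat / (θ - 1) - s * (1 + θ * vhat)) * (θ - 1) < 0 := by
        nlinarith
      have := neg_of_mul_neg_left h5 (by linarith)
      linarith
    have h1 := (hcont.eventually_lt continuousAt_const h0).filter_mono
      (nhdsWithin_le_nhds (s := Set.Ioi 0))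
    have h2 : ∀ᶠ ε : ℝ in 𝓝[>] 0, ε ∈ Set.Ioo 0 vhat := Ioo_mem_nhdsGT hv
    obtain ⟨ε, h3, h4⟩ := (h1.and h2).exists
    exact ⟨ε, h4.1, h4.2, by linarith⟩
  set w := vhat - ε with hw
  set v := θ * vhat + ε with hv'
  set u := θ * vhat - ε with hu
  have hw0 : 0 < w := by linarith
  have hvw : 0 < v - w := by nlinarith
  have hu0 : 0 < u := by nlinarith
  have hsub : uniformGeSet b id (ENNReal.ofReal vhat) ∩
      asymptoticEqSet b id (ENNReal.ofReal (θ * vhat)) ⊆ ⋃ i, boundedApproxSet b w v u i := by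
    rintro ξ ⟨⟨hξ, h1⟩, -, h2⟩
    rw [uniformExponent_eq] at h1
    rw [asymptoticExponent_eq] at h2
    have hU : UnifApprox b id w ξ := of_lt_iSup (P := (UnifApprox b id · ξ))
      (fun _ _ h H => H.mono hb h) h1 hv (by linarith)
    have hA : AsymApprox b id u ξ := of_lt_iSup (P := (AsymApprox b id · ξ))
      (fun _ _ h H => H.mono hb h) h2.ge hθv (by linarith)
    have hN : ¬ AsymApprox b id v ξ := not_of_iSup_lt (P := (AsymApprox b id · ξ))
      h2.le hθv.le (by linarith)
    obtain ⟨N₀, hN₀⟩ := eventually_atTop.1 hU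
    obtain ⟨C₀, hC₀⟩ := exists_rpow_le_of_not_asymApprox hb hξ hN
    exact Set.mem_iUnion.2 ⟨(⌊ξ⌋, N₀, C₀), ⟨Int.floor_le ξ, Int.lt_floor_add_one ξ⟩, hξ,
      hN₀, hC₀, hA⟩
  refine (dimH_mono hsub).trans ?_
  rw [dimH_iUnion]
  exact iSup_le fun i => dimH_boundedApproxSet_le hb hw0 hu0 (div_nonneg hw0.le hvw.le)
    (div_mul_cancel₀ _ hvw.ne') hε0 hε2 i

end UpperBound

/-! ### Distances read off from base `b` digits. -/

section Digits

open Real (ofDigits ofDigitsTerm ofDigits_nonneg ofDigits_le_one ofDigitsTerm_le ofDigitsTerm_nonneg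
  ofDigits_eq_sum_add_ofDigits abs_ofDigits_sub_ofDigits_le)

variable {b : ℕ}

lemma ofDigits_succ (d : ℕ → Fin b) :
    ofDigits d = ((d 0 : ℕ) + ofDigits fun i => d (i + 1)) / b := by
  rw [ofDigits_eq_sum_add_ofDigits d 1]
  simp only [Finset.sum_range_one, ofDigitsTerm, zero_add, pow_one]
  ring

lemma exists_pow_mul_ofDigits_eq (hb : 2 ≤ b) (d : ℕ → Fin b) (n : ℕ) :
    ∃ m : ℤ, (b : ℝ) ^ n * ofDigits d = m + ofDigits fun i => d (i + n) := by
  have hb0 : (b : ℝ) ≠ 0 := by positivity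
  induction n with
  | zero => exact ⟨0, by simp⟩
  | succ n ih =>
    obtain ⟨m, hm⟩ := ih
    refine ⟨b * m + (d n : ℕ), ?_⟩
    rw [pow_succ', mul_assoc, hm, ofDigits_succ fun i => d (i + n)]
    simp only [zero_add, add_right_comm _ 1 n, ← add_assoc]
    push_cast
    field_simp
    ring

lemma distNearestInt_pow_mul_ofDigits (hb : 2 ≤ b) (d : ℕ → Fin b) (n : ℕ) :
    distNearestInt ((b : ℝ) ^ n * ofDigits d) = distNearestInt (ofDigits fun i => d (i + n)) := by
  obtain ⟨m, hm⟩ := exists_pow_mul_ofDigits_eq hb d n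
  rw [hm, distNearestInt, distNearestInt, round_intCast_add, Int.cast_add,
    add_sub_add_left_eq_sub]

lemma le_distNearestInt {c y : ℝ} (h1 : c ≤ y) (h2 : y ≤ 1 - c) : c ≤ distNearestInt y := by
  unfold distNearestInt
  rcases le_or_gt (round y) 0 with h | h
  · have : (round y : ℝ) ≤ 0 := by exact_mod_cast h
    exact le_abs.2 (Or.inl (by linarith))
  · have : (1 : ℝ) ≤ round y := by exact_mod_cast h
    exact le_abs.2 (Or.inr (by linarith))

lemma distNearestInt_le_of_zeros (hb : 2 ≤ b) {d : ℕ → Fin b} {n t : ℕ}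
    (h : ∀ i < t, (d (n + i) : ℕ) = 0) :
    distNearestInt ((b : ℝ) ^ n * ofDigits d) ≤ ((b : ℝ) ^ t)⁻¹ := by
  rw [distNearestInt_pow_mul_ofDigits hb]
  have h1 := distNearestInt_le_abs_sub (ofDigits fun i => d (i + n)) 0
  rw [Int.cast_zero, sub_zero, abs_of_nonneg (ofDigits_nonneg _)] at h1
  refine h1.trans ?_
  rw [ofDigits_eq_sum_add_ofDigits _ t, Finset.sum_eq_zero, zero_add]
  · exact mul_le_of_le_one_right (by positivity) (ofDigits_le_one _)
  · intro i hi
    have := h i (Finset.mem_range.1 hi)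
    rw [add_comm] at this
    simp [ofDigitsTerm, this]

lemma sum_ofDigitsTerm_le (hb : 2 ≤ b) (d : ℕ → Fin b) (k : ℕ) :
    ∑ i ∈ Finset.range k, ofDigitsTerm d i ≤ 1 - ((b : ℝ) ^ k)⁻¹ := by
  have hb0 : (b : ℝ) ≠ 0 := by positivity
  induction k with
  | zero => simp
  | succ k ih =>
    rw [Finset.sum_range_succ]
    have h1 := ofDigitsTerm_le (digits := d) (n := k)
    have h2 : (b - 1 : ℝ) * ((b : ℝ) ^ (k + 1))⁻¹ = ((b : ℝ) ^ k)⁻¹ - ((b : ℝ) ^ (k + 1))⁻¹ := by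
      rw [pow_succ]; field_simp
    linarith

/-- After shifting by `n`, the digit 1 keeps the fractional part away from 0 and the digit 0 before
it keeps it away from 1. -/
lemma distNearestInt_ge_of_zero_one (hb : 2 ≤ b) {d : ℕ → Fin b} {n q : ℕ} (hq : n ≤ q)
    (h0 : (d q : ℕ) = 0) (h1 : (d (q + 1) : ℕ) = 1) :
    ((b : ℝ) ^ (q + 2 - n))⁻¹ ≤ distNearestInt ((b : ℝ) ^ n * ofDigits d) := by
  have hb2 : (2 : ℝ) ≤ b := by exact_mod_cast hb
  have hb0 : (0 : ℝ) < b := by linarith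
  rw [distNearestInt_pow_mul_ofDigits hb]
  obtain ⟨k, rfl⟩ := Nat.exists_eq_add_of_le' hq
  rw [show k + n + 2 - n = k + 2 by omega]
  set e := fun i => d (i + n) with he
  have hy := ofDigits_eq_sum_add_ofDigits e k
  rw [ofDigits_succ fun i => e (i + k), ofDigits_succ fun i => (fun i => e (i + k)) (i + 1)] at hy
  simp only [he, zero_add, h0, Nat.cast_zero] at hy
  rw [show 1 + k + n = k + n + 1 by ring, h1, Nat.cast_one] at hy
  set z := ofDigits fun i => d (i + 1 + 1 + k + n)
  have hz0 : 0 ≤ z := ofDigits_nonneg _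
  have hz1 : z ≤ 1 := ofDigits_le_one _
  have hs0 : 0 ≤ ∑ i ∈ Finset.range k, ofDigitsTerm (fun i => d (i + n)) i :=
    Finset.sum_nonneg fun _ _ => ofDigitsTerm_nonneg
  have hs1 := sum_ofDigitsTerm_le hb (fun i => d (i + n)) k
  set c := ((b : ℝ) ^ k)⁻¹ with hc
  have hc0 : 0 < c := by positivity
  have hpow : ((b : ℝ) ^ (k + 2))⁻¹ = c * (1 / b / b) := by
    rw [pow_add, mul_inv, ← hc]; field_simp
  have hi : 1 / (b : ℝ) ≤ 1 / 2 := one_div_le_one_div_of_le two_pos hb2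
  have hi0 : 0 < 1 / (b : ℝ) := by positivity
  have hdiv : (1 + z) / (b : ℝ) / b = (1 + z) * (1 / b / b) := by field_simp
  have hii : 1 / (b : ℝ) / b ≤ 1 / 4 := by
    rw [div_eq_mul_one_div]; nlinarith
  have hii0 : 0 < 1 / (b : ℝ) / b := by positivity
  rw [hpow]
  apply le_distNearestInt
  · rw [hy, hdiv]
    nlinarith [mul_nonneg hc0.le (mul_nonneg hz0 hii0.le)]
  · rw [hy, hdiv]
    have h3 : (1 + z) * (1 / b / b) ≤ 2 * (1 / 4 : ℝ) := by nlinarith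
    have h4 : c * ((1 + z) * (1 / b / b)) ≤ c * (2 * (1 / 4)) := by gcongr
    have h5 : c * (1 / b / b) ≤ c * (1 / 4) := by gcongr
    linarith

/-- Expansions which first differ at `j` and agree again at some `t > j` are far apart. -/
lemma ofDigits_sub_ofDigits_ge (hb : 2 ≤ b) {d d' : ℕ → Fin b} {j t : ℕ} (hjt : j < t)
    (heq : ∀ i < j, d i = d' i) (hlt : d j < d' j) (ht : d t = d' t) :
    ((b : ℝ) ^ (t + 1))⁻¹ ≤ ofDigits d' - ofDigits d := by
  have hb2 : (2 : ℝ) ≤ b := by exact_mod_cast hb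
  have hb0 : (0 : ℝ) < b := by linarith
  obtain ⟨k, rfl⟩ := Nat.exists_eq_add_of_lt hjt
  have key : ∀ e : ℕ → Fin b, ofDigits e = ∑ i ∈ Finset.range j, ofDigitsTerm e i +
      ((b : ℝ) ^ j)⁻¹ * (((e j : ℕ) + (∑ i ∈ Finset.range k, ofDigitsTerm (fun i => e (i + 1 + j)) i +
        ((b : ℝ) ^ k)⁻¹ * (((e (j + k + 1) : ℕ) + ofDigits fun i => e (i + 1 + k + 1 + j)) / b))) / b)
        := fun e => by
    rw [ofDigits_eq_sum_add_ofDigits e j, ofDigits_succ fun i => e (i + j),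
      ofDigits_eq_sum_add_ofDigits _ k, ofDigits_succ fun i => _]
    simp only [zero_add]
    rw [show k + 1 + j = j + k + 1 by ring]
  have hsum : ∑ i ∈ Finset.range j, ofDigitsTerm d i = ∑ i ∈ Finset.range j, ofDigitsTerm d' i :=
    Finset.sum_congr rfl fun i hi => by simp [ofDigitsTerm, heq i (Finset.mem_range.1 hi)]
  have h1 := key d
  have h2 := key d'
  rw [hsum, ht] at h1
  have hs1 := sum_ofDigitsTerm_le hb (fun i => d (i + 1 + j)) k
  have hs2 : 0 ≤ ∑ i ∈ Finset.range k, ofDigitsTerm (fun i => d' (i + 1 + j)) i :=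
    Finset.sum_nonneg fun _ _ => ofDigitsTerm_nonneg
  have hz1 := ofDigits_le_one fun i => d (i + 1 + k + 1 + j)
  have hz2 := ofDigits_nonneg fun i => d' (i + 1 + k + 1 + j)
  set z := ofDigits fun i => d (i + 1 + k + 1 + j)
  set z' := ofDigits fun i => d' (i + 1 + k + 1 + j)
  set s := ∑ i ∈ Finset.range k, ofDigitsTerm (fun i => d (i + 1 + j)) i
  set s' := ∑ i ∈ Finset.range k, ofDigitsTerm (fun i => d' (i + 1 + j)) i
  have hd : ((d j : ℕ) : ℝ) + 1 ≤ (d' j : ℕ) := by exact_mod_cast hlt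
  rw [h1, h2, add_sub_add_left_eq_sub, ← mul_sub, ← sub_div]
  set m := ((d' (j + k + 1) : ℕ) : ℝ)
  set c := ((b : ℝ) ^ k)⁻¹ with hc
  have hc0 : 0 < c := by positivity
  have hpow : ((b : ℝ) ^ (j + k + 1 + 1))⁻¹ = ((b : ℝ) ^ j)⁻¹ * (c / b / b) := by
    rw [show j + k + 1 + 1 = j + (k + 2) by ring, pow_add, mul_inv, pow_add _ k, mul_inv, ← hc]
    field_simp
  rw [hpow]
  -- The common digit at `t` limits the difference of the tails to `1 / b` instead of 1, so carrying
  -- cannot cancel the difference at `j`.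
  have h3 : (m + z) / b - (m + z') / b ≤ 1 / b := by
    rw [← sub_div]; gcongr; linarith
  have h4 : c * ((m + z) / b) - c * ((m + z') / b) ≤ c * (1 / b) := by
    rw [← mul_sub]; gcongr
  have h5 : 2 * (c * (1 / b)) ≤ c := by
    have hi : 1 / (b : ℝ) ≤ 1 / 2 := one_div_le_one_div_of_le two_pos hb2
    nlinarith
  have h6 : c / b = c * (1 / b) := by ring
  gcongr
  linarith

end Digits

/-! ### Dimension of a set of numbers with prescribed and free digits. -/

section Holder

/-- Hölder dependence of one parametrization on another bounds the dimension from below. -/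
lemma dimH_range_le_of_holder {X : Type*} {f g : X → ℝ} {C s : ℝ} (hC : 0 ≤ C) (hs : 0 < s)
    (h : ∀ x y, |g x - g y| ≤ C * |f x - f y| ^ s) :
    dimH (Set.range g) ≤ dimH (Set.range f) / ENNReal.ofReal s := by
  rcases isEmpty_or_nonempty X with hX | hX
  · rw [Set.range_eq_empty g]; simp
  let F : ℝ → ℝ := fun y => g (Function.invFun f y)
  have hinv : ∀ x, f (Function.invFun f (f x)) = f x := fun x => Function.invFun_eq ⟨x, rfl⟩
  -- Although `f` need not be injective, the Hölder bound forces `g` to agree wherever `f` does.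
  have hF : ∀ x, F (f x) = g x := fun x => by
    have h1 := h (Function.invFun f (f x)) x
    rw [hinv, sub_self, abs_zero, Real.zero_rpow hs.ne', mul_zero] at h1
    exact sub_eq_zero.1 (abs_nonpos_iff.1 h1)
  have himage : F '' Set.range f = Set.range g := by
    rw [← Set.range_comp]
    exact congrArg Set.range (funext hF)
  rw [← himage]
  refine HolderOnWith.dimH_image_le (C := C.toNNReal) (r := s.toNNReal) ?_
    (Real.toNNReal_pos.2 hs)
  rintro _ ⟨x, rfl⟩ _ ⟨y, rfl⟩
  rw [hF, hF, edist_dist, edist_dist, Real.dist_eq, Real.dist_eq, Real.coe_toNNReal s hs.le,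
    ENNReal.ofReal_rpow_of_nonneg (abs_nonneg _) hs.le]
  change _ ≤ ENNReal.ofReal C * _
  rw [← ENNReal.ofReal_mul hC]
  exact ENNReal.ofReal_le_ofReal (h x y)

open Real (ofDigits ofDigits_SurjOn abs_ofDigits_sub_ofDigits_le)

variable {b : ℕ}

open Classical in
/-- The digit sequence which carries the successive terms of `x` at the positions in `F`, and the
prescribed digits `f` at the other positions. -/
noncomputable def interleave (F : ℕ → Prop) (f x : ℕ → Fin b) (j : ℕ) : Fin b :=
  if F j then x (Nat.count F j) else f j

open Classical in
lemma exists_count_eq {F : ℕ → Prop} {m j : ℕ} (h : m < Nat.count F j) :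
    ∃ i < j, F i ∧ Nat.count F i = m := by
  induction j with
  | zero => simp at h
  | succ j ih =>
    by_cases hm : m < Nat.count F j
    · obtain ⟨i, hi, h1⟩ := ih hm
      exact ⟨i, by omega, h1⟩
    · rw [Nat.count_succ] at h
      by_cases hF : F j
      · rw [if_pos hF] at h
        exact ⟨j, by omega, hF, by omega⟩
      · rw [if_neg hF] at h
        omega

-- Two such numbers first differing at `j` share at least `s * j - C` free digits, and a fixed digit
-- within distance `l` keeps them about `b ^ (-j)` apart. Hence the free number is an `s`-Hölder
-- function of the interleaved one, and free numbers fill `[0, 1]`.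
open Classical in
lemma le_dimH_range_interleave (hb : 2 ≤ b) {F : ℕ → Prop} {f : ℕ → Fin b} {s C : ℝ} {l : ℕ}
    (hs : 0 < s) (hgap : ∀ j, ∃ t, j < t ∧ t ≤ j + l ∧ ¬ F t)
    (hcount : ∀ j : ℕ, s * j - C ≤ Nat.count F j) :
    ENNReal.ofReal s ≤ dimH (Set.range fun x : ℕ → Fin b => ofDigits (interleave F f x)) := by
  have hb1 : (1 : ℝ) < b := by exact_mod_cast (by omega : 1 < b)
  have hb0 : (0 : ℝ) < b := by linarith
  have hagree : ∀ x y : ℕ → Fin b, ∀ j, (∀ i < j, interleave F f x i = interleave F f y i) →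
      ∀ m < Nat.count F j, x m = y m := by
    intro x y j h m hm
    obtain ⟨i, hi, hFi, rfl⟩ := exists_count_eq hm
    simpa [interleave, hFi] using h i hi
  have hsurj : 1 ≤ dimH (Set.range (ofDigits (b := b))) := by
    have h1 : Set.Icc (0 : ℝ) 1 ⊆ Set.range (ofDigits (b := b)) := by
      have := ofDigits_SurjOn (b := b) (by omega)
      rwa [Set.SurjOn, Set.image_univ] at this
    have h2 : dimH (Set.Icc (0 : ℝ) 1) = 1 := by
      rw [Real.dimH_of_nonempty_interior (by rw [interior_Icc]; simp)]
      simp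
    rw [← h2]
    exact dimH_mono h1
  have hholder := dimH_range_le_of_holder (X := ℕ → Fin b)
    (f := fun x => ofDigits (interleave F f x)) (g := ofDigits)
    (C := (b : ℝ) ^ (C + s * (l + 1))) (by positivity) hs ?_
  · have h := hsurj.trans hholder
    rw [ENNReal.le_div_iff_mul_le (Or.inl (by simpa using hs)) (Or.inl (by simp)), one_mul] at h
    exact h
  intro x y
  by_cases hxy : interleave F f x = interleave F f y
  · have : x = y := by
      funext m
      obtain ⟨j, hj⟩ := exists_nat_gt ((m + C) / s)
      rw [div_lt_iff₀ hs] at hj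
      refine hagree x y j (fun i _ => by rw [hxy]) m ?_
      have := hcount j
      exact_mod_cast (by linarith : (m : ℝ) < Nat.count F j)
    subst this
    simp [Real.zero_rpow hs.ne']
  · have hex : ∃ j, interleave F f x j ≠ interleave F f y j := Function.ne_iff.1 hxy
    obtain ⟨j, hj, hmin⟩ : ∃ j, interleave F f x j ≠ interleave F f y j ∧
        ∀ i < j, interleave F f x i = interleave F f y i :=
      ⟨Nat.find hex, Nat.find_spec hex, fun i hi => not_not.1 (Nat.find_min hex hi)⟩
    obtain ⟨t, ht1, ht2, ht3⟩ := hgap j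
    have hteq : interleave F f x t = interleave F f y t := by simp [interleave, ht3]
    have hsep : ((b : ℝ) ^ (t + 1))⁻¹ ≤
        |ofDigits (interleave F f x) - ofDigits (interleave F f y)| := by
      rcases lt_or_gt_of_ne hj with h | h
      · rw [abs_sub_comm]
        exact (ofDigits_sub_ofDigits_ge hb ht1 hmin h hteq).trans (le_abs_self _)
      · exact (ofDigits_sub_ofDigits_ge hb ht1 (fun i hi => (hmin i hi).symm) h hteq.symm).trans
          (le_abs_self _)
    refine (abs_ofDigits_sub_ofDigits_le (hagree x y j hmin)).trans ?_
    calc ((b : ℝ) ^ Nat.count F j)⁻¹ = (b : ℝ) ^ (-(Nat.count F j : ℝ)) := by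
          rw [Real.rpow_neg hb0.le, Real.rpow_natCast]
      _ ≤ (b : ℝ) ^ (C + s * (l + 1) + -((t + 1 : ℕ) : ℝ) * s) := by
          apply Real.rpow_le_rpow_of_exponent_le hb1.le
          have h1 := hcount j
          have h2 : (t : ℝ) ≤ j + l := by exact_mod_cast ht2
          push_cast
          nlinarith
      _ = (b : ℝ) ^ (C + s * (l + 1)) * (((b : ℝ) ^ (t + 1))⁻¹) ^ s := by
          rw [Real.rpow_add hb0, Real.rpow_mul hb0.le, Real.rpow_neg hb0.le, Real.rpow_natCast]
      _ ≤ _ := by gcongr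

end Holder

/-! ### Numbers with geometrically placed zero blocks, and their exponents. -/

section Blocks

/-- The index `i` lies in one of the blocks `[A θ ^ k, κ A θ ^ k)`. -/
def IsZeroBlock (θ κ A : ℝ) (i : ℕ) : Prop :=
  ∃ k : ℕ, A * θ ^ k ≤ i ∧ (i : ℝ) < κ * (A * θ ^ k)

/-- The positions of free digits, when digits are grouped into words of length `l`. -/
def IsFree (θ κ A : ℝ) (l j : ℕ) : Prop := ¬ IsZeroBlock θ κ A (j / l) ∧ 2 ≤ j % l

open Classical in
/-- The prescribed digits: words outside the blocks start with `01`, all other digits vanish. -/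
noncomputable def fixedDigit {b : ℕ} (hb : 2 ≤ b) (θ κ A : ℝ) (l j : ℕ) : Fin b :=
  if ¬ IsZeroBlock θ κ A (j / l) ∧ j % l = 1 then ⟨1, by omega⟩ else ⟨0, by omega⟩

/-- The real number with free digits `x` outside the blocks. -/
noncomputable def blockReal {b : ℕ} (hb : 2 ≤ b) (θ κ A : ℝ) (l : ℕ) (x : ℕ → Fin b) : ℝ :=
  Real.ofDigits (interleave (IsFree θ κ A l) (fixedDigit hb θ κ A l) x)

variable {b : ℕ} {θ κ A : ℝ} {l : ℕ}

lemma le_of_mul_pow_lt (hθ : 1 < θ) (hA : 0 < A) {k K : ℕ} (h : A * θ ^ k < A * θ ^ (K + 1)) :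
    A * θ ^ k ≤ A * θ ^ K := by
  have h1 := lt_of_mul_lt_mul_left h hA.le
  have h2 := (pow_lt_pow_iff_right₀ hθ).1 h1
  exact mul_le_mul_of_nonneg_left (pow_le_pow_right₀ hθ.le (by omega)) hA.le

/-- The condition `1 ≤ A * (θ - κ)` leaves room for at least one whole word between consecutive
blocks. -/
lemma not_isZeroBlock_ceil (hθ : 1 < θ) (hκ : 0 < κ) (hA : 0 < A) (hAθ : 1 ≤ A * (θ - κ)) (k : ℕ) :
    ¬ IsZeroBlock θ κ A ⌈κ * (A * θ ^ k)⌉₊ := by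
  rintro ⟨m, h1, h2⟩
  have hpow : 1 ≤ θ ^ k := one_le_pow₀ hθ.le
  have h3 := Nat.ceil_lt_add_one (a := κ * (A * θ ^ k)) (by positivity)
  have h4 := Nat.le_ceil (κ * (A * θ ^ k))
  have h5 : A * θ ^ m < A * θ ^ (k + 1) := by
    rw [pow_succ]
    nlinarith
  have h6 := mul_le_mul_of_nonneg_left (le_of_mul_pow_lt hθ hA h5) hκ.le
  linarith

lemma interleave_eq_zero_of_isZeroBlock (hb : 2 ≤ b) (x : ℕ → Fin b) {j : ℕ}
    (h : IsZeroBlock θ κ A (j / l)) :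
    (interleave (IsFree θ κ A l) (fixedDigit hb θ κ A l) x j : ℕ) = 0 := by
  simp [interleave, IsFree, fixedDigit, h]

lemma interleave_word_start (hb : 2 ≤ b) (hl : 3 ≤ l) (x : ℕ → Fin b) {i : ℕ}
    (h : ¬ IsZeroBlock θ κ A i) :
    (interleave (IsFree θ κ A l) (fixedDigit hb θ κ A l) x (l * i) : ℕ) = 0 ∧
    (interleave (IsFree θ κ A l) (fixedDigit hb θ κ A l) x (l * i + 1) : ℕ) = 1 := by
  have h1 : (l * i + 1) / l = i := by
    rw [Nat.mul_add_div (by omega), Nat.div_eq_of_lt (by omega), add_zero]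
  have h2 : (l * i + 1) % l = 1 := by
    rw [Nat.mul_add_mod, Nat.mod_eq_of_lt (by omega)]
  have h3 : (l * i) / l = i := Nat.mul_div_cancel_left _ (by omega)
  constructor
  · simp [interleave, IsFree, fixedDigit]
  · simp [interleave, IsFree, fixedDigit, h1, h2, h]

lemma distNearestInt_blockReal_le (hb : 2 ≤ b) (hl : 3 ≤ l) (hκ : 1 ≤ κ) (hA : 0 < A)
    (hθ : 1 < θ) (x : ℕ → Fin b) (k : ℕ) :
    distNearestInt ((b : ℝ) ^ (l * ⌈A * θ ^ k⌉₊) * blockReal hb θ κ A l x) ≤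
      (b : ℝ) ^ (-(l * ((κ - 1) * (A * θ ^ k) - 1))) := by
  have hb1 : (1 : ℝ) ≤ b := by exact_mod_cast (by omega : 1 ≤ b)
  have hB : 0 ≤ A * θ ^ k := by positivity
  set B := A * θ ^ k with hBdef
  have hle : ⌈B⌉₊ ≤ ⌈κ * B⌉₊ := Nat.ceil_mono (by nlinarith)
  refine (distNearestInt_le_of_zeros hb (t := l * (⌈κ * B⌉₊ - ⌈B⌉₊)) fun i hi => ?_).trans ?_
  · apply interleave_eq_zero_of_isZeroBlock
    rw [Nat.mul_add_div (by omega)]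
    have hi' : i / l < ⌈κ * B⌉₊ - ⌈B⌉₊ := Nat.div_lt_of_lt_mul hi
    refine ⟨k, ?_, ?_⟩
    · rw [← hBdef]
      exact (Nat.le_ceil B).trans (by exact_mod_cast Nat.le_add_right _ _)
    · rw [← hBdef]
      exact Nat.lt_ceil.1 (by omega)
  · rw [← Real.rpow_natCast, ← Real.rpow_neg (by positivity)]
    apply Real.rpow_le_rpow_of_exponent_le hb1
    push_cast [Nat.cast_sub hle]
    have h1 := Nat.le_ceil (κ * B)
    have h2 := Nat.ceil_lt_add_one hB
    have hl0 : (0 : ℝ) ≤ l := by positivity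
    nlinarith

/-- Look for the next word starting with `01`. If the word after `n` lies in the block starting at
`B`, that block must be skipped, at a cost of about `(κ - 1) * B` words; otherwise `B = 0`. The
clause on `K` says that before block `K + 1` is reached, only blocks up to `K` matter. -/
lemma exists_le_distNearestInt_blockReal (hb : 2 ≤ b) (hl : 3 ≤ l) (hκ : 1 ≤ κ) (hA : 0 < A)
    (hθ : 1 < θ) (hAθ : 1 ≤ A * (θ - κ)) (x : ℕ → Fin b) (n : ℕ) :
    ∃ B : ℝ, 0 ≤ B ∧ B ≤ (n / l : ℕ) + 1 ∧
      (∀ K : ℕ, ((n / l : ℕ) : ℝ) + 1 < A * θ ^ (K + 1) → B ≤ A * θ ^ K) ∧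
      (b : ℝ) ^ (-(l * ((κ - 1) * B + 3))) ≤
        distNearestInt ((b : ℝ) ^ n * blockReal hb θ κ A l x) := by
  have hb1 : (1 : ℝ) ≤ b := by exact_mod_cast (by omega : 1 ≤ b)
  have hl3 : (3 : ℝ) ≤ l := by exact_mod_cast hl
  have hn1 : l * (n / l) ≤ n := Nat.mul_div_le n l
  have hn2 : n < l * (n / l + 1) := by
    have := Nat.lt_mul_div_succ n (by omega : 0 < l); simpa using this
  have key : ∀ (i : ℕ) (B : ℝ), n / l + 1 ≤ i → ¬ IsZeroBlock θ κ A i →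
      (i : ℝ) ≤ (n / l : ℕ) + (κ - 1) * B + 2 →
      (b : ℝ) ^ (-(l * ((κ - 1) * B + 3))) ≤
        distNearestInt ((b : ℝ) ^ n * blockReal hb θ κ A l x) := by
    intro i B hi hZ hiB
    obtain ⟨h0, h1⟩ := interleave_word_start hb hl x hZ
    have hq : n ≤ l * i := hn2.le.trans (Nat.mul_le_mul_left l hi)
    refine le_trans ?_ (distNearestInt_ge_of_zero_one hb hq h0 h1)
    rw [← Real.rpow_natCast, ← Real.rpow_neg (by positivity)]
    apply Real.rpow_le_rpow_of_exponent_le hb1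
    rw [Nat.cast_sub (by omega)]
    push_cast
    have h3 : (l : ℝ) * (n / l : ℕ) ≤ n := by exact_mod_cast hn1
    nlinarith
  by_cases hZ : IsZeroBlock θ κ A (n / l + 1)
  · obtain ⟨k, h1, h2⟩ := hZ
    have hB : 0 ≤ A * θ ^ k := by positivity
    push_cast at h1 h2
    refine ⟨A * θ ^ k, hB, h1, fun K hK => le_of_mul_pow_lt hθ hA (h1.trans_lt hK), ?_⟩
    refine key ⌈κ * (A * θ ^ k)⌉₊ _ ?_ (not_isZeroBlock_ceil hθ (by linarith) hA hAθ k) ?_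
    · have := Nat.le_ceil (κ * (A * θ ^ k))
      exact_mod_cast h2.le.trans this
    · have := Nat.ceil_lt_add_one (a := κ * (A * θ ^ k)) (by positivity)
      linarith
  · refine ⟨0, le_rfl, by positivity, fun K _ => by positivity, key _ 0 le_rfl hZ ?_⟩
    push_cast
    linarith

lemma exists_lt_mul_pow (hA : 1 ≤ A) (hθ : 1 < θ) (X : ℝ) : ∃ k : ℕ, X < A * θ ^ k := by
  obtain ⟨k, hk⟩ := pow_unbounded_of_one_lt X hθ
  exact ⟨k, hk.trans_le (le_mul_of_one_le_left (by positivity) hA)⟩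

/-- For a rational number all these distances are multiples of the reciprocal of its denominator, so
they cannot be positive and arbitrarily small. -/
lemma irrational_of_distNearestInt {ξ : ℝ}
    (hpos : ∀ n : ℕ, 0 < distNearestInt ((b : ℝ) ^ n * ξ))
    (hsmall : ∀ ε > 0, ∃ n : ℕ, distNearestInt ((b : ℝ) ^ n * ξ) < ε) : Irrational ξ := by
  rintro ⟨r, rfl⟩
  have hden : (0 : ℝ) < r.den := by exact_mod_cast r.den_pos
  obtain ⟨n, hn⟩ := hsmall (1 / r.den) (by positivity)
  have h1 := hpos n
  set z : ℤ := (b : ℤ) ^ n * r.num - round ((b : ℝ) ^ n * (r : ℝ)) * r.den with hz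
  have h2 : distNearestInt ((b : ℝ) ^ n * (r : ℝ)) = |(z : ℝ)| / r.den := by
    rw [distNearestInt, eq_div_iff hden.ne', ← abs_of_pos hden, ← abs_mul, hz]
    congr 1
    push_cast
    have : (r : ℝ) * r.den = r.num := by exact_mod_cast Rat.mul_den_eq_num r
    rw [sub_mul, mul_assoc, this]
  rw [h2] at h1 hn
  rw [div_lt_div_iff_of_pos_right hden] at hn
  have h3 : |z| < 1 := by exact_mod_cast hn
  have h4 : z = 0 := Int.abs_lt_one_iff.1 h3
  simp [h4] at h1

section ExponentsOfBlockReal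

variable (hb : 2 ≤ b) {v : ℝ} (x : ℕ → Fin b)

lemma asymApprox_blockReal {u : ℝ} (hA : 1 ≤ A) (hθ : 1 < θ) (hl : 3 ≤ l)
    (hu : 0 ≤ u) (huv : u < θ * v) :
    AsymApprox b id u (blockReal hb θ (1 + θ * v) A l x) := by
  have hb1 : (1 : ℝ) < b := by exact_mod_cast (by omega : 1 < b)
  have hl3 : (3 : ℝ) ≤ l := by exact_mod_cast hl
  refine frequently_atTop.2 fun n₀ => ?_
  obtain ⟨k, hk⟩ := exists_lt_mul_pow hA hθ (max n₀ ((u + 1) / (θ * v - u)))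
  obtain ⟨hk1, hk2⟩ := max_lt_iff.1 hk
  rw [div_lt_iff₀ (by linarith)] at hk2
  have hB : 0 ≤ A * θ ^ k := by positivity
  have h1 := distNearestInt_blockReal_le hb hl (κ := 1 + θ * v) (A := A)
    (by nlinarith) (by linarith) hθ x k
  have h2 := Nat.le_ceil (A * θ ^ k)
  have h3 := Nat.ceil_lt_add_one hB
  refine ⟨l * ⌈A * θ ^ k⌉₊, ?_, h1.trans_lt ?_⟩
  · have : n₀ ≤ ⌈A * θ ^ k⌉₊ := by exact_mod_cast hk1.le.trans h2
    exact this.trans (Nat.le_mul_of_pos_left _ (by omega))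
  · rw [Real.rpow_lt_rpow_left_iff hb1]
    simp only [id]
    push_cast
    have h4 : u * ⌈A * θ ^ k⌉₊ ≤ u * (A * θ ^ k + 1) := by gcongr
    nlinarith

lemma not_asymApprox_blockReal {u : ℝ} (hv : 0 < v) (hA : 1 ≤ A) (hθ : 1 < θ) (hl : 3 ≤ l)
    (hAθ : 1 ≤ A * (θ - (1 + θ * v))) (huv : θ * v < u) :
    ¬ AsymApprox b id u (blockReal hb θ (1 + θ * v) A l x) := by
  have hb1 : (1 : ℝ) < b := by exact_mod_cast (by omega : 1 < b)
  have hl3 : (3 : ℝ) ≤ l := by exact_mod_cast hl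
  have hc : 0 < θ * v := by positivity
  simp only [AsymApprox, not_frequently, not_lt, id]
  filter_upwards [tendsto_natCast_atTop_atTop.eventually_ge_atTop
    ((θ * v * l + 3 * l) / (u - θ * v))] with n hn
  rw [div_le_iff₀ (by linarith)] at hn
  obtain ⟨B, hB0, hB1, -, hB⟩ := exists_le_distNearestInt_blockReal hb hl (κ := 1 + θ * v) (A := A)
    (by linarith) (by linarith) hθ hAθ x n
  refine le_trans ?_ hB
  apply Real.rpow_le_rpow_of_exponent_le hb1.le
  have h3 : (l : ℝ) * (n / l : ℕ) ≤ n := by exact_mod_cast Nat.mul_div_le n l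
  have h4 : l * B ≤ n + l := by nlinarith
  have h5 : θ * v * (l * B) ≤ θ * v * (n + l) := by gcongr
  nlinarith

lemma unifApprox_blockReal {w : ℝ} (hv : 0 < v) (hA : 1 ≤ A) (hθ : 1 < θ) (hl : 3 ≤ l)
    (hw : 0 ≤ w) (hwv : w < v) :
    UnifApprox b id w (blockReal hb θ (1 + θ * v) A l x) := by
  have hb1 : (1 : ℝ) < b := by exact_mod_cast (by omega : 1 < b)
  have hl3 : (3 : ℝ) ≤ l := by exact_mod_cast hl
  have hl0 : (0 : ℝ) < l := by linarith
  have hA0 : 0 < A := by linarith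
  unfold UnifApprox
  filter_upwards [tendsto_natCast_atTop_atTop.eventually_ge_atTop (l * (A + 1)),
    tendsto_natCast_atTop_atTop.eventually_ge_atTop (l * ((w + 1) / (v - w) + 1))] with N hN1 hN2
  -- The last block starting before `N`; the `- 1` leaves room for rounding its start up to a whole
  -- word.
  obtain ⟨k, hk1, hk2⟩ := exists_nat_pow_near (x := ((N : ℝ) / l - 1) / A) (y := θ) (by
    rw [one_le_div hA0, le_sub_iff_add_le, le_div_iff₀ hl0]; linarith) hθ
  rw [le_div_iff₀ hA0, le_sub_iff_add_le, le_div_iff₀ hl0] at hk1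
  rw [div_lt_iff₀ hA0, sub_lt_iff_lt_add, div_lt_iff₀ hl0, pow_succ] at hk2
  have hB : 0 ≤ A * θ ^ k := by positivity
  have h1 := distNearestInt_blockReal_le hb hl (κ := 1 + θ * v) (A := A)
    (by nlinarith) hA0 hθ x k
  have h3 := Nat.ceil_lt_add_one hB
  refine ⟨l * ⌈A * θ ^ k⌉₊, ?_, h1.trans_lt ?_⟩
  · have : (l : ℝ) * ⌈A * θ ^ k⌉₊ ≤ N := by nlinarith
    exact_mod_cast this
  · rw [Real.rpow_lt_rpow_left_iff hb1]
    simp only [id]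
    set B := A * θ ^ k with hBdef
    have h4 : (N : ℝ) < l * (θ * B + 1) := by rw [hBdef]; linarith
    have h5 : (w + 1) / (v - w) < θ * B := by
      have := hN2.trans_lt h4
      have := lt_of_mul_lt_mul_left this hl0.le
      linarith
    rw [div_lt_iff₀ (by linarith)] at h5
    have h6 : w * N ≤ w * (l * (θ * B + 1)) := by gcongr
    nlinarith

lemma not_unifApprox_blockReal {w : ℝ} (hv : 0 < v) (hA : 1 ≤ A) (hθ : 1 < θ) (hl : 3 ≤ l)
    (hAθ : 1 ≤ A * (θ - (1 + θ * v))) (hwv : v < w) :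
    ¬ UnifApprox b id w (blockReal hb θ (1 + θ * v) A l x) := by
  have hb1 : (1 : ℝ) < b := by exact_mod_cast (by omega : 1 < b)
  have hl3 : (3 : ℝ) ≤ l := by exact_mod_cast hl
  have hl0 : (0 : ℝ) < l := by linarith
  have hc : 0 < θ * v := by positivity
  simp only [UnifApprox, not_eventually, not_exists, not_and, not_lt, id]
  refine frequently_atTop.2 fun N₀ => ?_
  obtain ⟨K, hK⟩ := exists_lt_mul_pow hA hθ (max (N₀ + 3) ((3 + 3 * w) / (w - v)))
  obtain ⟨hK1, hK2⟩ := max_lt_iff.1 hK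
  have hK3 : A * θ ^ K ≤ A * θ ^ (K + 1) := by
    gcongr
    · exact hθ.le
    · omega
  set T := A * θ ^ (K + 1) with hT
  have hN0 : (0 : ℝ) ≤ N₀ := by positivity
  replace hK1 := hK1.trans_le hK3
  replace hK2 := hK2.trans_le hK3
  rw [div_lt_iff₀ (by linarith)] at hK2
  have hN1 : (⌊l * (T - 2)⌋₊ : ℝ) ≤ l * (T - 2) := Nat.floor_le (by nlinarith)
  have hN2 := Nat.lt_floor_add_one (l * (T - 2))
  -- Just before block `K + 1` starts, the best approximation still comes from a block starting no
  -- later than `A * θ ^ K = T / θ`; its exponent `θ * v * B` is at most `v * T`.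
  refine ⟨⌊l * (T - 2)⌋₊, ?_, fun n hn => ?_⟩
  · have : (N₀ : ℝ) ≤ ⌊l * (T - 2)⌋₊ := by nlinarith
    exact_mod_cast this
  · obtain ⟨B, hB0, -, hB1, hB⟩ := exists_le_distNearestInt_blockReal hb hl (κ := 1 + θ * v) (A := A)
      (by linarith) (by linarith) hθ hAθ x n
    refine le_trans ?_ hB
    apply Real.rpow_le_rpow_of_exponent_le hb1.le
    have h3 : (l : ℝ) * (n / l : ℕ) ≤ n := by exact_mod_cast Nat.mul_div_le n l
    have hn' : (n : ℝ) ≤ ⌊l * (T - 2)⌋₊ := by exact_mod_cast hn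
    have h4 : ((n / l : ℕ) : ℝ) ≤ T - 2 :=
      le_of_mul_le_mul_left (h3.trans (hn'.trans hN1)) hl0
    have h5 := hB1 K (by linarith)
    have h6 : θ * v * B ≤ v * T := by
      have : v * T = θ * v * (A * θ ^ K) := by rw [hT, pow_succ]; ring
      rw [this]; gcongr
    have h7 : w * (l * (T - 2) - 1) ≤ w * ⌊l * (T - 2)⌋₊ :=
      mul_le_mul_of_nonneg_left (by linarith) (by linarith)
    have h8 : l * ((1 + θ * v - 1) * B + 3) ≤ l * (v * T + 3) :=
      mul_le_mul_of_nonneg_left (by linarith) hl0.le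
    have h9 : l * (3 + 3 * w) ≤ l * (T * (w - v)) := by gcongr
    nlinarith

/-- The numbers with prescribed zero blocks have the expected exponents. -/
theorem blockReal_mem (hv : 0 < v) (hA : 1 ≤ A) (hθ : 1 < θ) (hl : 3 ≤ l)
    (hAθ : 1 ≤ A * (θ - (1 + θ * v))) :
    blockReal hb θ (1 + θ * v) A l x ∈ uniformEqSet b id (ENNReal.ofReal v) ∩
      asymptoticEqSet b id (ENNReal.ofReal (θ * v)) := by
  have hb1 : (1 : ℝ) < b := by exact_mod_cast (by omega : 1 < b)
  have hb0 : (0 : ℝ) < b := by linarith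
  have hc : 0 < θ * v := by positivity
  have hirr : Irrational (blockReal hb θ (1 + θ * v) A l x) := by
    refine irrational_of_distNearestInt (b := b) (fun n => ?_) fun ε hε => ?_
    · obtain ⟨B, -, -, -, hB⟩ := exists_le_distNearestInt_blockReal hb hl (κ := 1 + θ * v) (A := A)
        (by linarith) (by linarith) hθ hAθ x n
      exact lt_of_lt_of_le (by positivity) hB
    · have h1 : (b : ℝ) ^ (-(θ * v / 2)) < 1 :=
        Real.rpow_lt_one_of_one_lt_of_neg hb1 (by linarith)
      have h2 : ∀ᶠ n : ℕ in atTop, (b : ℝ) ^ (-(θ * v / 2 * n)) < ε := by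
        have := (tendsto_pow_atTop_nhds_zero_of_lt_one (by positivity) h1).eventually_lt_const hε
        filter_upwards [this] with n hn
        rw [← Real.rpow_natCast, ← Real.rpow_mul hb0.le] at hn
        rwa [← neg_mul]
      have h3 := asymApprox_blockReal hb x hA hθ hl (v := v) (u := θ * v / 2)
        (by linarith) (by linarith)
      obtain ⟨n, hn1, hn2⟩ := (h3.and_eventually h2).exists
      exact ⟨n, hn1.trans hn2⟩
  refine ⟨⟨hirr, ?_⟩, hirr, ?_⟩
  · rw [uniformExponent_eq]
    exact iSup_eq_ofReal (P := (UnifApprox b id · _))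
      (fun w hw hwv => unifApprox_blockReal hb x hv hA hθ hl hw hwv)
      (fun w hwv => not_unifApprox_blockReal hb x hv hA hθ hl hAθ hwv)
  · rw [asymptoticExponent_eq]
    exact iSup_eq_ofReal (P := (AsymApprox b id · _))
      (fun u hu huv => asymApprox_blockReal hb x hA hθ hl hu huv)
      (fun u huv => not_asymApprox_blockReal hb x hv hA hθ hl hAθ huv)

end ExponentsOfBlockReal

end Blocks

/-! ### Density of the free digits. -/

section Counting

variable {θ κ A : ℝ}

-- Blocks before the last sum to a geometric series. The proportion of zero words is largest at the
-- end of a block, which gives the constant; each block adds at most 1 by rounding.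
open Classical in
lemma card_zeroBlock_le_of_pow (hθ : 1 < θ) (hκ : 1 ≤ κ) (hκθ : κ ≤ θ) (hA : 0 < A) {I K : ℕ}
    (h1 : A * θ ^ K ≤ I) (h2 : (I : ℝ) < A * θ ^ (K + 1)) :
    (((Finset.range I).filter (IsZeroBlock θ κ A)).card : ℝ) ≤
      (1 - (1 - (κ - 1) / (θ - 1)) / κ) * I + (K + 1) := by
  have hθ1 : 0 < θ - 1 := by linarith
  have hκ0 : 0 < κ := by linarith
  set B : ℕ → ℝ := fun k => A * θ ^ k with hB
  have hB0 : ∀ k, 0 ≤ B k := fun k => by positivity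
  have hsub : (Finset.range I).filter (IsZeroBlock θ κ A) ⊆
      (Finset.range (K + 1)).biUnion fun k => Finset.Ico ⌈B k⌉₊ (min ⌈κ * B k⌉₊ I) := by
    intro i hi
    obtain ⟨hiI, k, hk1, hk2⟩ := Finset.mem_filter.1 hi
    rw [Finset.mem_range] at hiI
    refine Finset.mem_biUnion.2 ⟨k, Finset.mem_range.2 ?_, Finset.mem_Ico.2 ⟨Nat.ceil_le.2 hk1,
      lt_min (Nat.lt_ceil.2 hk2) hiI⟩⟩
    have h3 : (i : ℝ) < I := by exact_mod_cast hiI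
    have h4 : A * θ ^ k < A * θ ^ (K + 1) := by linarith
    exact (pow_lt_pow_iff_right₀ hθ).1 (lt_of_mul_lt_mul_left h4 hA.le)
  have hcard : ∀ k ≤ K, ((Finset.Ico ⌈B k⌉₊ (min ⌈κ * B k⌉₊ I)).card : ℝ) ≤
      min (κ * B k + 1) I - B k := by
    intro k hk
    have h3 : B k ≤ I := le_trans (mul_le_mul_of_nonneg_left
      (pow_le_pow_right₀ hθ.le hk) hA.le) h1
    have h4 : B k ≤ κ * B k := by have := hB0 k; nlinarith
    rw [Nat.card_Ico]
    rcases le_total ⌈B k⌉₊ (min ⌈κ * B k⌉₊ I) with h | h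
    · rw [Nat.cast_sub h, Nat.cast_min]
      have h5 := Nat.le_ceil (B k)
      have h6 := (Nat.ceil_lt_add_one ((hB0 k).trans h4)).le
      have h7 : min (⌈κ * B k⌉₊ : ℝ) I ≤ min (κ * B k + 1) I := min_le_min_right _ h6
      linarith
    · rw [Nat.sub_eq_zero_of_le h, Nat.cast_zero, sub_nonneg]
      exact le_min (by linarith) h3
  have hsum : (((Finset.range I).filter (IsZeroBlock θ κ A)).card : ℝ) ≤
      ∑ k ∈ Finset.range (K + 1), (min (κ * B k + 1) I - B k) := by
    refine (Nat.cast_le.2 ((Finset.card_le_card hsub).trans Finset.card_biUnion_le)).trans ?_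
    push_cast
    exact Finset.sum_le_sum fun k hk => hcard k (by have := Finset.mem_range.1 hk; omega)
  have hgeom : ∑ k ∈ Finset.range K, (min (κ * B k + 1) I - B k) ≤
      (κ - 1) / (θ - 1) * B K + K := by
    have h3 : ∑ k ∈ Finset.range K, (min (κ * B k + 1) I - B k) ≤
        ∑ k ∈ Finset.range K, ((κ - 1) * A * θ ^ k + 1) :=
      Finset.sum_le_sum fun k _ => by
        have := min_le_left (κ * B k + 1) (I : ℝ)
        simp only [hB] at this ⊢
        linarith
    refine h3.trans ?_
    rw [Finset.sum_add_distrib, ← Finset.mul_sum, geom_sum_eq hθ.ne', Finset.sum_const,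
      Finset.card_range, nsmul_eq_mul, mul_one]
    have h4 : (κ - 1) * A * ((θ ^ K - 1) / (θ - 1)) =
        (κ - 1) / (θ - 1) * B K - (κ - 1) * A / (θ - 1) := by
      simp only [hB]; field_simp
    have h5 : 0 ≤ (κ - 1) * A / (θ - 1) :=
      div_nonneg (mul_nonneg (by linarith) hA.le) hθ1.le
    linarith
  rw [Finset.sum_range_succ] at hsum
  refine hsum.trans ?_
  set D := (1 - (κ - 1) / (θ - 1)) / κ with hD
  have hDκ : (κ - 1) / (θ - 1) = 1 - D * κ := by rw [hD]; field_simp; ring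
  have hD0 : 0 ≤ D := by
    apply div_nonneg _ hκ0.le
    rw [sub_nonneg, div_le_one hθ1]; linarith
  have hD1 : D ≤ 1 := by
    rw [hD, div_le_one hκ0]
    have : 0 ≤ (κ - 1) / (θ - 1) := div_nonneg (by linarith) hθ1.le
    linarith
  rw [hDκ] at hgeom
  -- The main term is now `min (κ * B K) I - D * κ * B K`. Past the block, `D ≤ 1` bounds it by `(1
  -- - D) * I`; inside the block, `0 ≤ D` does.
  rcases le_total (κ * B K) I with h | h
  · have h3 := min_le_left (κ * B K + 1) (I : ℝ)
    have h4 := mul_le_mul_of_nonneg_left h (by linarith : 0 ≤ 1 - D)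
    linarith
  · have h3 := min_le_right (κ * B K + 1) (I : ℝ)
    have h4 := mul_le_mul_of_nonneg_left h hD0
    linarith

/-- The number of blocks is logarithmic in the length, so the rounding errors are negligible. -/
lemma exists_nat_le_mul_pow_add (hθ : 1 < θ) {ε : ℝ} (hε : 0 < ε) :
    ∃ C : ℝ, 0 ≤ C ∧ ∀ K : ℕ, (K : ℝ) ≤ ε * θ ^ K + C := by
  have h := (tendsto_pow_const_div_const_pow_of_one_lt 1 hθ).eventually_le_const hε
  obtain ⟨K₀, hK₀⟩ := eventually_atTop.1 h
  refine ⟨K₀, by positivity, fun K => ?_⟩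
  have hpos : 0 < θ ^ K := by positivity
  rcases le_total K₀ K with hK | hK
  · have := hK₀ K hK
    rw [pow_one, div_le_iff₀ hpos] at this
    have : (0 : ℝ) ≤ K₀ := by positivity
    linarith
  · have : (K : ℝ) ≤ K₀ := by exact_mod_cast hK
    have := mul_pos hε hpos
    linarith

open Classical in
lemma exists_card_zeroBlock_le (hθ : 1 < θ) (hκ : 1 ≤ κ) (hκθ : κ ≤ θ) (hA : 0 < A) {ε : ℝ}
    (hε : 0 < ε) : ∃ C : ℝ, 0 ≤ C ∧ ∀ I : ℕ,
      (((Finset.range I).filter (IsZeroBlock θ κ A)).card : ℝ) ≤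
        (1 - (1 - (κ - 1) / (θ - 1)) / κ + ε) * I + C := by
  obtain ⟨C, hC, hK⟩ := exists_nat_le_mul_pow_add hθ (mul_pos hε hA)
  have hD1 : (1 - (κ - 1) / (θ - 1)) / κ ≤ 1 := by
    rw [div_le_one (by linarith)]
    have : 0 ≤ (κ - 1) / (θ - 1) := div_nonneg (by linarith) (by linarith)
    linarith
  refine ⟨C + 1 + A, by linarith, fun I => ?_⟩
  rcases le_or_gt A I with h | h
  · obtain ⟨K, h1, h2⟩ := exists_nat_pow_near ((one_le_div hA).2 h) hθ
    rw [le_div_iff₀ hA] at h1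
    rw [div_lt_iff₀ hA] at h2
    have h3 := card_zeroBlock_le_of_pow hθ hκ hκθ hA (I := I) (K := K) (by linarith) (by linarith)
    have h4 := hK K
    have h5 := mul_le_mul_of_nonneg_left h1 hε.le
    linarith
  · have h3 : (((Finset.range I).filter (IsZeroBlock θ κ A)).card : ℝ) ≤ I := by
      have := Finset.card_filter_le (Finset.range I) (IsZeroBlock θ κ A)
      rw [Finset.card_range] at this
      exact Nat.cast_le.2 this
    have h4 : 0 ≤ (1 - (1 - (κ - 1) / (θ - 1)) / κ + ε) * I := by
      have : 0 ≤ 1 - (1 - (κ - 1) / (θ - 1)) / κ + ε := by linarith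
      positivity
    linarith

open Classical in
lemma count_isFree_ge {l : ℕ} (hl : 2 ≤ l) (I : ℕ) :
    (l - 2) * (I - ((Finset.range I).filter (IsZeroBlock θ κ A)).card : ℝ) ≤
      Nat.count (IsFree θ κ A l) (l * I) := by
  induction I with
  | zero => simp
  | succ I ih =>
    rw [Nat.mul_succ, Nat.count_add, Finset.range_add_one, Finset.filter_insert]
    have hmod : ∀ k < l, (l * I + k) / l = I ∧ (l * I + k) % l = k := fun k hk => by
      rw [Nat.mul_add_div (by omega), Nat.div_eq_of_lt hk, Nat.mul_add_mod, Nat.mod_eq_of_lt hk]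
      simp
    by_cases hZ : IsZeroBlock θ κ A I
    · rw [if_pos hZ, Finset.card_insert_of_notMem (by simp)]
      push_cast
      have : (0 : ℝ) ≤ Nat.count (fun k => IsFree θ κ A l (l * I + k)) l := by positivity
      linarith
    · rw [if_neg hZ]
      have h1 : l - 2 ≤ Nat.count (fun k => IsFree θ κ A l (l * I + k)) l := by
        rw [Nat.count_eq_card_filter_range, ← Nat.card_Ico 2 l]
        refine Finset.card_le_card fun k hk => ?_
        obtain ⟨hk1, hk2⟩ := Finset.mem_Ico.1 hk
        obtain ⟨h1, h2⟩ := hmod k hk2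
        exact Finset.mem_filter.2 ⟨Finset.mem_range.2 hk2, by rwa [h1], by rwa [h2]⟩
      have h2 : (l - 2 : ℝ) ≤ Nat.count (fun k => IsFree θ κ A l (l * I + k)) l := by
        have h3 : ((l - 2 : ℕ) : ℝ) = l - 2 := by rw [Nat.cast_sub hl]; norm_num
        rw [← h3]
        exact Nat.cast_le.2 h1
      push_cast
      linarith

open Classical in
lemma exists_count_isFree_ge {l : ℕ} (hl : 3 ≤ l) (hθ : 1 < θ) (hκ : 1 ≤ κ) (hκθ : κ ≤ θ)
    (hA : 0 < A) {σ : ℝ} (hσ0 : 0 ≤ σ) (hσ : σ < (1 - (κ - 1) / (θ - 1)) / κ) :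
    ∃ C : ℝ, ∀ j : ℕ, σ * ((l - 2) / l) * j - C ≤ Nat.count (IsFree θ κ A l) j := by
  obtain ⟨C, hC, h⟩ := exists_card_zeroBlock_le hθ hκ hκθ hA (sub_pos.2 hσ)
  have hl3 : (3 : ℝ) ≤ l := by exact_mod_cast hl
  refine ⟨(l - 2) * (σ + C), fun j => ?_⟩
  have h1 := h (j / l)
  have h2 := count_isFree_ge (θ := θ) (κ := κ) (A := A) (l := l) (by omega) (j / l)
  have h3 : (Nat.count (IsFree θ κ A l) (l * (j / l)) : ℝ) ≤ Nat.count (IsFree θ κ A l) j :=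
    Nat.cast_le.2 (Nat.count_monotone _ (Nat.mul_div_le j l))
  have h4 : (j : ℝ) / l ≤ (j / l : ℕ) + 1 := by
    rw [div_le_iff₀ (by linarith)]
    have := Nat.lt_mul_div_succ j (by omega : 0 < l)
    have h5 : (j : ℝ) < l * ((j / l : ℕ) + 1) := by exact_mod_cast this
    linarith
  refine le_trans ?_ (h2.trans h3)
  have h5 : σ * (j / l) ≤ σ * ((j / l : ℕ) + 1) := mul_le_mul_of_nonneg_left h4 hσ0
  have h6 : σ * ((l - 2) / l) * j - (l - 2) * (σ + C) = (l - 2) * (σ * (j / l) - (σ + C)) := by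
    ring
  rw [h6]
  exact mul_le_mul_of_nonneg_left (by linarith) (by linarith)

end Counting

/-! ### The lower bound for the dimension. -/

section LowerBound

variable {b : ℕ}

/-- Lower bound for the dimension of the points with uniform exponent `v` and asymptotic exponent
`θ * v`. -/
theorem le_dimH_uniformEq_inter_asymptoticEq (hb : 2 ≤ b) {v θ : ℝ} (hv : 0 < v)
    (hθ1 : 1 < θ) (hθ : 1 + θ * v ≤ θ) :
    ENNReal.ofReal ((θ - 1 - θ * v) / ((θ - 1) * (1 + θ * v))) ≤
      dimH (uniformEqSet b id (ENNReal.ofReal v) ∩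
        asymptoticEqSet b id (ENNReal.ofReal (θ * v))) := by
  rcases hθ.eq_or_lt with h0 | hlt
  · rw [show θ - 1 - θ * v = 0 by linarith]
    simp
  have hθv : 0 < θ * v := by positivity
  set D := (θ - 1 - θ * v) / ((θ - 1) * (1 + θ * v)) with hD
  have hDeq : (1 - (1 + θ * v - 1) / (θ - 1)) / (1 + θ * v) = D := by
    have h1 : θ - 1 ≠ 0 := by linarith
    have h2 : 1 + θ * v ≠ 0 := by linarith
    rw [hD]
    field_simp
    ring
  refine ENNReal.le_of_forall_nnreal_lt fun r hr => ?_
  have hr' : (r : ℝ) < D := by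
    rw [← ENNReal.ofReal_coe_nnreal] at hr
    exact (ENNReal.ofReal_lt_ofReal_iff'.1 hr).1
  set σ := (r + D) / 2 with hσ
  have hrσ : (r : ℝ) < σ := by linarith
  have hσ0 : 0 < σ := r.coe_nonneg.trans_lt hrσ
  -- Long words make the loss factor `(l - 2) / l` from the prefixes `01` small enough that `r < σ *
  -- ((l - 2) / l)`.
  obtain ⟨l₀, hl₀⟩ := exists_nat_gt (2 * σ / (σ - r))
  set l := l₀ + 3 with hl
  have hl' : 2 * σ / (σ - r) < l := by rw [hl]; push_cast; linarith
  have hl0 : (0 : ℝ) < l := by rw [hl]; push_cast; positivity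
  rw [div_lt_iff₀ (by linarith)] at hl'
  set s := σ * ((l - 2) / l) with hs
  have hrs : (r : ℝ) < s := by
    rw [hs, ← mul_div_assoc, lt_div_iff₀ hl0]
    linarith
  have hs0 : 0 < s := r.coe_nonneg.trans_lt hrs
  set A := max 1 (1 / (θ - (1 + θ * v))) with hA
  have hA1 : 1 ≤ A := le_max_left _ _
  have hAθ : 1 ≤ A * (θ - (1 + θ * v)) := by
    have := le_max_right 1 (1 / (θ - (1 + θ * v)))
    rwa [div_le_iff₀ (by linarith)] at this
  classical
  obtain ⟨C, hC⟩ := exists_count_isFree_ge (θ := θ) (κ := 1 + θ * v) (A := A) (l := l) (by omega)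
    hθ1 (by linarith) hlt.le (by linarith) hσ0.le (by rw [hDeq]; linarith)
  have hgap : ∀ j, ∃ t, j < t ∧ t ≤ j + l ∧ ¬ IsFree θ (1 + θ * v) A l t := by
    intro j
    -- The start of the next word is never free.
    refine ⟨l * (j / l + 1), Nat.lt_mul_div_succ j (by omega), ?_, fun h => ?_⟩
    · rw [Nat.mul_succ]
      exact Nat.add_le_add_right (Nat.mul_div_le j l) l
    · have := h.2
      simp at this
  have key := le_dimH_range_interleave hb (f := fixedDigit hb θ (1 + θ * v) A l) hs0 hgap
    (by convert hC)
  rw [← ENNReal.ofReal_coe_nnreal]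
  refine (ENNReal.ofReal_le_ofReal hrs.le).trans (key.trans (dimH_mono ?_))
  rintro _ ⟨x, rfl⟩
  exact blockReal_mem hb x hv hA1 hθ1 (by omega) hAθ

end LowerBound

end RestrictedDenominators

theorem theorem15 (b : ℕ) (hb : 2 ≤ b) (a : ℕ → ℕ) (ha_pos : ∀ n, 0 < a n) (ha : StrictMono a)
    (hη : RestrictedDenominators.ratioLimsup a = 1)
    (vhat θ : ℝ) (hv : vhat ∈ Set.Ioo (0 : ℝ) 1) (hθ : 1 / (1 - vhat) ≤ θ) :
    dimH (RestrictedDenominators.uniformEqSet b a (ENNReal.ofReal vhat) ∩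
        RestrictedDenominators.asymptoticEqSet b a (ENNReal.ofReal (θ * vhat))) =
      ENNReal.ofReal ((θ - 1 - θ * vhat) / ((θ - 1) * (1 + θ * vhat))) ∧
    dimH (RestrictedDenominators.uniformGeSet b a (ENNReal.ofReal vhat) ∩
        RestrictedDenominators.asymptoticEqSet b a (ENNReal.ofReal (θ * vhat))) =
      ENNReal.ofReal ((θ - 1 - θ * vhat) / ((θ - 1) * (1 + θ * vhat))) := by
  open RestrictedDenominators in
  obtain ⟨hv0, hv1⟩ := hv
  have hθ' : 1 + θ * vhat ≤ θ := by
    rw [div_le_iff₀ (by linarith)] at hθ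
    linarith
  have hθ1 : 1 < θ := by
    refine lt_of_lt_of_le ?_ hθ
    rw [lt_div_iff₀ (by linarith)]
    linarith
  have hEq : uniformEqSet b a (ENNReal.ofReal vhat) = uniformEqSet b id (ENNReal.ofReal vhat) := by
    simp only [uniformEqSet, uniformExponent_eq_id hb ha_pos ha hη]
  have hGe : uniformGeSet b a (ENNReal.ofReal vhat) = uniformGeSet b id (ENNReal.ofReal vhat) := by
    simp only [uniformGeSet, uniformExponent_eq_id hb ha_pos ha hη]
  have hAs : asymptoticEqSet b a (ENNReal.ofReal (θ * vhat)) =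
      asymptoticEqSet b id (ENNReal.ofReal (θ * vhat)) := by
    simp only [asymptoticEqSet, asymptoticExponent_eq_id hb ha_pos ha hη]
  rw [hEq, hGe, hAs]
  have hupper := dimH_uniformGe_inter_asymptoticEq_le hb hv0 hθ1
  have hlower := le_dimH_uniformEq_inter_asymptoticEq hb hv0 hθ1 hθ'
  have hsub : uniformEqSet b id (ENNReal.ofReal vhat) ∩
      asymptoticEqSet b id (ENNReal.ofReal (θ * vhat)) ⊆
      uniformGeSet b id (ENNReal.ofReal vhat) ∩
        asymptoticEqSet b id (ENNReal.ofReal (θ * vhat)) :=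
    fun ξ hξ => ⟨⟨hξ.1.1, hξ.1.2.ge⟩, hξ.2⟩
  have hmono := dimH_mono hsub
  exact ⟨le_antisymm (hmono.trans hupper) hlower, le_antisymm hupper (hlower.trans hmono)⟩
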